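/- **Theorem (strong completeness of $\mathsf{FOFST}$).** Let $\sigma$ be a signature with a countably infinite set of constants and countably many predicate symbols, each of positive arity. Formulas are built from atoms $P(t_1,\dots,t_n)$ and $s\approx t$ (terms are variables $v_0,v_1,\dots$ and constants) by $\wedge,\vee,\to,\Box,\Diamond,\forall x,\exists x,\bot$; write $\neg\varphi=\varphi\to\bot$, $\top=\neg\bot$. A sentence is a formula without free variables. Below, $\varphi,\psi$ are sentences; $\varphi(x),\psi(x)$ are formulas in which no variable other than $x$ is free (possibly $x$ is not free either), and $\varphi(c)$ is the result of replacing the free occurrences of $x$ by the constant $c$. The logic $\mathsf{FOFST}$ is the set of sentences derivable from the axioms - substitution instances (by sentences) of theorems of intuitionistic propositional logic; - $\Box(\varphi\wedge\psi)\leftrightarrow(\Box\varphi\wedge\Box\psi)$, $\ \Box\top$, $\ \Diamond(\varphi\vee\psi)\leftrightarrow(\Diamond\varphi\vee\Diamond\psi)$, $\ \neg\Diamond\bot$; - $(\Diamond\varphi\to\Box\psi)\to\Box(\varphi\to\psi)$, $\ \Diamond(\varphi\to\psi)\to(\Box\varphi\to\Diamond\psi)$; - $\forall x\varphi(x)\to\varphi(c)$,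 $\ \varphi(c)\to\exists x\varphi(x)$, $\ \forall x(\varphi(x)\to\psi)\to(\exists x\varphi(x)\to\psi)$, $\ \forall x(\varphi\to\psi(x))\to(\varphi\to\forall x\psi(x))$; - $c\approx c$, and $c_1\approx c_2\to(\varphi(c_1)\to\varphi(c_2))$ for $\varphi(x)$ containing no $\Box$ or $\Diamond$; - $\Box\varphi\to\varphi$ and $\varphi\to\Diamond\varphi$ by the rules: modus ponens; from $\varphi$ infer $\forall x\,\varphi'$, where $\varphi'$ is $\varphi$ with every occurrence of a constant $c$ replaced by $x$, provided no occurrence of $c$ in $\varphi$ lies in the scope of a quantifier binding $x$; from $\varphi\to\psi$ infer $\Box\varphi\to\Box\psi$ and $\Diamond\varphi\to\Diamond\psi$. For a set $\Gamma$ of sentences, $\Gamma\vdash_{\mathsf{FOFST}}\varphi$ means that $\bigwedge_i\gamma_i\to\varphi$ is in $\mathsf{FOFST}$ for some finitely many $\gamma_i\in\Gamma$. A frame consists of a set $W$, a partial order $\preccurlyeq$ on $W$, a relation $M$ on $W$, sets $D(w)$ and equivalence relations $\sim_w$ on $D(w)$ for $w\in W$, such that: if $w\,M\,v\preccurlyeq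 v'$ then $w\preccurlyeq w'\,M\,v'$ for some $w'$; if $w\,M\,v$ and $w\preccurlyeq w'$ then $v\preccurlyeq v'$ and $w'\,M\,v'$ for some $v'$; $w\preccurlyeq w'$ implies $D(w)\subseteq D(w')$ and ${\sim_w}\subseteq{\sim_{w'}}$; $w\,M\,v$ implies $D(w)\subseteq D(v)$. A model on a frame assigns to each constant an element of $\bigcap_w D(w)$ and to each world $w$ and $n$-ary predicate $P$ a $\sim_w$-invariant subset of $D(w)^n$, increasing along $\preccurlyeq$. Truth at $w$ under an assignment $g$ of elements of $D(w)$ to the variables: an atom $P(\bar t)$ holds if the denotation of $\bar t$ lies in the set assigned to $P$ at $w$, $s\approx t$ is interpreted by $\sim_w$, $\wedge,\vee,\bot$ as usual, and - $w\Vdash_g\varphi\to\psi$ iff for all $w'\succcurlyeq w$, $w'\Vdash_g\varphi$ implies $w'\Vdash_g\psi$; - $w\Vdash_g\Box\varphi$ iff $v\Vdash_g\varphi$ whenever $w\preccurlyeq w'\,M\,v$; $\quad w\Vdash_g\Diamond\varphi$ iff $v\Vdash_g\varphi$ for some $v$ with $w\,M\,v$; - $w\Vdash_g\forall x\varphi$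 iff $w'\Vdash_{g[x:=a]}\varphi$ for all $w'\succcurlyeq w$ and $a\in D(w')$; $\quad w\Vdash_g\exists x\varphi$ iff $w\Vdash_{g[x:=a]}\varphi$ for some $a\in D(w)$. A sentence is true at $w$ if it holds at $w$ under every such assignment. Then $\mathsf{FOFST}$ is complete with respect to the class of frames whose modal relation $M$ is reflexive: for every set $\Gamma$ of sentences and every sentence $\varphi$, if $\varphi$ is true at every world of every model on such a frame at which all members of $\Gamma$ are true, then $\Gamma\vdash_{\mathsf{FOFST}}\varphi$. -/

import Mathlib

universe u

namespace FOFS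

/-! ## Language -/

/-- A signature: countably infinitely many constants and countably many predicate symbols, each
of positive arity. -/
structure Signature where
  Const : Type u
  Pred : Type u
  arity : Pred → ℕ
  arity_pos : ∀ P, 0 < arity P
  countable_const : Countable Const
  infinite_const : Infinite Const
  countable_pred : Countable Pred

/-- Terms: the variables `v₀, v₁, …` and the constants of the signature. -/
inductive Term (σ : Signature.{u}) : Type u where
  | var (x : ℕ) : Term σ
  | cst (c : σ.Const) : Term σ

/-- Formulas of first-order modal logic over `σ`. -/
inductive Formula (σ : Signature.{u}) : Type u where
  | atom (P : σ.Pred) (t : Fin (σ.arity P) → Term σ) : Formula σ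
  | eq (s t : Term σ) : Formula σ
  | and (φ ψ : Formula σ) : Formula σ
  | or (φ ψ : Formula σ) : Formula σ
  | imp (φ ψ : Formula σ) : Formula σ
  | box (φ : Formula σ) : Formula σ
  | dia (φ : Formula σ) : Formula σ
  | all (x : ℕ) (φ : Formula σ) : Formula σ
  | ex (x : ℕ) (φ : Formula σ) : Formula σ
  | bot : Formula σ

namespace Term

variable {σ : Signature.{u}}

open Classical in
/-- Replace the variable `x` by the constant `c`. -/
noncomputable def inst (x : ℕ) (c : σ.Const) : Term σ → Term σ
  | var y => if y = x then cst c else var y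
  | cst d => cst d

open Classical in
/-- Replace the constant `c` by the variable `x`. -/
noncomputable def replaceConst (c : σ.Const) (x : ℕ) : Term σ → Term σ
  | var y => var y
  | cst d => if d = c then var x else cst d

end Term

namespace Formula

variable {σ : Signature.{u}}

/-- Negation, as an abbreviation. -/
def neg (φ : Formula σ) : Formula σ := imp φ bot

/-- The true sentence, as an abbreviation. -/
def top : Formula σ := neg bot

/-- The biconditional, as an abbreviation. -/
def iff (φ ψ : Formula σ) : Formula σ := and (imp φ ψ) (imp ψ φ)

/-- The set of free variables. -/
def fv : Formula σ → Set ℕ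
  | atom _ t => {x | ∃ i, t i = Term.var x}
  | eq s t => {x | s = Term.var x ∨ t = Term.var x}
  | and φ ψ => fv φ ∪ fv ψ
  | or φ ψ => fv φ ∪ fv ψ
  | imp φ ψ => fv φ ∪ fv ψ
  | box φ => fv φ
  | dia φ => fv φ
  | all x φ => fv φ \ {x}
  | ex x φ => fv φ \ {x}
  | bot => ∅

/-- A sentence is a formula without free variables. -/
def IsSentence (φ : Formula σ) : Prop := fv φ = ∅

/-- No variable other than `x` is free in the formula; such a formula is written `φ(x)`. -/
def FreeOnly (x : ℕ) (φ : Formula σ) : Prop := fv φ ⊆ {x}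

/-- For a formula `φ(x)`, the formula `φ(c)`: every free occurrence of `x` is replaced by `c`. -/
noncomputable def inst (x : ℕ) (c : σ.Const) : Formula σ → Formula σ
  | atom P t => atom P fun i => (t i).inst x c
  | eq s t => eq (s.inst x c) (t.inst x c)
  | and φ ψ => and (inst x c φ) (inst x c ψ)
  | or φ ψ => or (inst x c φ) (inst x c ψ)
  | imp φ ψ => imp (inst x c φ) (inst x c ψ)
  | box φ => box (inst x c φ)
  | dia φ => dia (inst x c φ)
  | all y φ => if y = x then all y φ else all y (inst x c φ)
  | ex y φ => if y = x then ex y φ else ex y (inst x c φ)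
  | bot => bot

/-- Every occurrence of the constant `c` is replaced by the variable `x`. -/
noncomputable def replaceConst (c : σ.Const) (x : ℕ) : Formula σ → Formula σ
  | atom P t => atom P fun i => (t i).replaceConst c x
  | eq s t => eq (s.replaceConst c x) (t.replaceConst c x)
  | and φ ψ => and (replaceConst c x φ) (replaceConst c x ψ)
  | or φ ψ => or (replaceConst c x φ) (replaceConst c x ψ)
  | imp φ ψ => imp (replaceConst c x φ) (replaceConst c x ψ)
  | box φ => box (replaceConst c x φ)
  | dia φ => dia (replaceConst c x φ)
  | all y φ => all y (replaceConst c x φ)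
  | ex y φ => ex y (replaceConst c x φ)
  | bot => bot

/-- The constant `c` occurs in the formula. -/
def HasConst (c : σ.Const) : Formula σ → Prop
  | atom _ t => ∃ i, t i = Term.cst c
  | eq s t => s = Term.cst c ∨ t = Term.cst c
  | and φ ψ => HasConst c φ ∨ HasConst c ψ
  | or φ ψ => HasConst c φ ∨ HasConst c ψ
  | imp φ ψ => HasConst c φ ∨ HasConst c ψ
  | box φ => HasConst c φ
  | dia φ => HasConst c φ
  | all _ φ => HasConst c φ
  | ex _ φ => HasConst c φ
  | bot => False

/-- The variable `x` is substitutable for the constant `c`: no occurrence of `c` lies in the scope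
of a quantifier binding `x`. -/
def Substitutable (x : ℕ) (c : σ.Const) : Formula σ → Prop
  | atom _ _ => True
  | eq _ _ => True
  | and φ ψ => Substitutable x c φ ∧ Substitutable x c ψ
  | or φ ψ => Substitutable x c φ ∧ Substitutable x c ψ
  | imp φ ψ => Substitutable x c φ ∧ Substitutable x c ψ
  | box φ => Substitutable x c φ
  | dia φ => Substitutable x c φ
  | all y φ => (HasConst c φ → y ≠ x) ∧ Substitutable x c φ
  | ex y φ => (HasConst c φ → y ≠ x) ∧ Substitutable x c φ
  | bot => True

/-- The formula contains neither a box nor a diamond. -/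
def ModalFree : Formula σ → Prop
  | atom _ _ => True
  | eq _ _ => True
  | and φ ψ => ModalFree φ ∧ ModalFree ψ
  | or φ ψ => ModalFree φ ∧ ModalFree ψ
  | imp φ ψ => ModalFree φ ∧ ModalFree ψ
  | box _ => False
  | dia _ => False
  | all _ φ => ModalFree φ
  | ex _ φ => ModalFree φ
  | bot => True

/-- The conjunction of a finite list of formulas (the empty conjunction is the true sentence). -/
def conj : List (Formula σ) → Formula σ
  | [] => top
  | φ :: l => and φ (conj l)

end Formula

/-! ## Intuitionistic propositional calculus -/

/-- Propositional formulas. -/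
inductive PropForm : Type where
  | atom (p : ℕ) : PropForm
  | bot : PropForm
  | and (A B : PropForm) : PropForm
  | or (A B : PropForm) : PropForm
  | imp (A B : PropForm) : PropForm

/-- Theorems of the intuitionistic propositional calculus. -/
inductive IPC : PropForm → Prop where
  | k (A B : PropForm) : IPC (.imp A (.imp B A))
  | s (A B C : PropForm) :
      IPC (.imp (.imp A (.imp B C)) (.imp (.imp A B) (.imp A C)))
  | and_left (A B : PropForm) : IPC (.imp (.and A B) A)
  | and_right (A B : PropForm) : IPC (.imp (.and A B) B)
  | and_intro (A B : PropForm) : IPC (.imp A (.imp B (.and A B)))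
  | or_left (A B : PropForm) : IPC (.imp A (.or A B))
  | or_right (A B : PropForm) : IPC (.imp B (.or A B))
  | or_elim (A B C : PropForm) :
      IPC (.imp (.imp A C) (.imp (.imp B C) (.imp (.or A B) C)))
  | efq (A : PropForm) : IPC (.imp .bot A)
  | mp {A B : PropForm} : IPC (.imp A B) → IPC A → IPC B

/-- Substitution of first-order modal formulas for the atoms of a propositional formula. -/
def PropForm.subst {σ : Signature.{u}} (f : ℕ → Formula σ) : PropForm → Formula σ
  | atom p => f p
  | bot => .bot
  | and A B => .and (A.subst f) (B.subst f)
  | or A B => .or (A.subst f) (B.subst f)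
  | imp A B => .imp (A.subst f) (B.subst f)

/-! ## The Hilbert system -/

open Formula in
/-- Theorems of the logic obtained from the first-order Fischer Servi logic by adding the members
of `Ax` as axioms; the rules apply to all theorems. -/
inductive Thm {σ : Signature.{u}} (Ax : Set (Formula σ)) : Formula σ → Prop where
  | ax {φ : Formula σ} : φ ∈ Ax → Thm Ax φ
  | int {A : PropForm} (f : ℕ → Formula σ) :
      IPC A → (∀ p, IsSentence (f p)) → Thm Ax (A.subst f)
  | box_and {φ ψ : Formula σ} : IsSentence φ → IsSentence ψ →
      Thm Ax (iff (box (and φ ψ)) (and (box φ) (box ψ)))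
  | box_top : Thm Ax (box top)
  | dia_or {φ ψ : Formula σ} : IsSentence φ → IsSentence ψ →
      Thm Ax (iff (dia (or φ ψ)) (or (dia φ) (dia ψ)))
  | dia_bot : Thm Ax (neg (dia bot))
  | fs1 {φ ψ : Formula σ} : IsSentence φ → IsSentence ψ →
      Thm Ax (imp (imp (dia φ) (box ψ)) (box (imp φ ψ)))
  | fs2 {φ ψ : Formula σ} : IsSentence φ → IsSentence ψ →
      Thm Ax (imp (dia (imp φ ψ)) (imp (box φ) (dia ψ)))
  | univ {φ : Formula σ} (x : ℕ) (c : σ.Const) : FreeOnly x φ →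
      Thm Ax (imp (all x φ) (φ.inst x c))
  | exist {φ : Formula σ} (x : ℕ) (c : σ.Const) : FreeOnly x φ →
      Thm Ax (imp (φ.inst x c) (ex x φ))
  | all_ant {φ ψ : Formula σ} (x : ℕ) : FreeOnly x φ → IsSentence ψ →
      Thm Ax (imp (all x (imp φ ψ)) (imp (ex x φ) ψ))
  | all_con {φ ψ : Formula σ} (x : ℕ) : IsSentence φ → FreeOnly x ψ →
      Thm Ax (imp (all x (imp φ ψ)) (imp φ (all x ψ)))
  | id_ref (c : σ.Const) : Thm Ax (eq (.cst c) (.cst c))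
  | id_sub {φ : Formula σ} (x : ℕ) (c d : σ.Const) : FreeOnly x φ → ModalFree φ →
      Thm Ax (imp (eq (.cst c) (.cst d)) (imp (φ.inst x c) (φ.inst x d)))
  | mp {φ ψ : Formula σ} : Thm Ax (imp φ ψ) → Thm Ax φ → Thm Ax ψ
  | gen {φ : Formula σ} (x : ℕ) (c : σ.Const) : Thm Ax φ → Substitutable x c φ →
      Thm Ax (all x (φ.replaceConst c x))
  | reg_box {φ ψ : Formula σ} : Thm Ax (imp φ ψ) → Thm Ax (imp (box φ) (box ψ))
  | reg_dia {φ ψ : Formula σ} : Thm Ax (imp φ ψ) → Thm Ax (imp (dia φ) (dia ψ))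

/-- Derivability from a set of sentences: some finite conjunction of members of `Γ` provably
implies `φ`. -/
def Provable {σ : Signature.{u}} (Ax Γ : Set (Formula σ)) (φ : Formula σ) : Prop :=
  ∃ l : List (Formula σ), (∀ γ ∈ l, γ ∈ Γ) ∧ Thm Ax (.imp (.conj l) φ)

/-- The additional axioms `□φ → φ` and `φ → ◇φ`, for all sentences `φ`. -/
def axiomsT (σ : Signature.{u}) : Set (Formula σ) :=
  {χ | ∃ φ : Formula σ, φ.IsSentence ∧ (χ = .imp (.box φ) φ ∨ χ = .imp φ (.dia φ))}

/-! ## Relational semantics -/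

/-- A Fischer Servi frame. -/
structure FSFrame where
  W : Type u
  le : W → W → Prop
  M : W → W → Prop
  le_refl : ∀ w, le w w
  le_trans : ∀ w₁ w₂ w₃, le w₁ w₂ → le w₂ w₃ → le w₁ w₃
  le_antisymm : ∀ w₁ w₂, le w₁ w₂ → le w₂ w₁ → w₁ = w₂
  fc1 : ∀ w v v₁, M w v → le v v₁ → ∃ w₁, le w w₁ ∧ M w₁ v₁
  fc2 : ∀ w v w₁, M w v → le w w₁ → ∃ v₁, le v v₁ ∧ M w₁ v₁

/-- A frame for first-order Fischer Servi logic: a Fischer Servi frame with a domain system.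
The domains are subsets of an ambient type `D`, and `eqv w` is an equivalence relation on the
set `dom w`. -/
structure Frame extends FSFrame.{u} where
  D : Type u
  dom : W → Set D
  dom_le : ∀ w w₁, le w w₁ → dom w ⊆ dom w₁
  dom_M : ∀ w v, M w v → dom w ⊆ dom v
  eqv : W → D → D → Prop
  eqv_dom : ∀ w a b, eqv w a b → a ∈ dom w ∧ b ∈ dom w
  eqv_refl : ∀ w, ∀ a ∈ dom w, eqv w a a
  eqv_symm : ∀ w a b, eqv w a b → eqv w b a
  eqv_trans : ∀ w a b c, eqv w a b → eqv w b c → eqv w a c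
  eqv_le : ∀ w w₁ a b, le w w₁ → eqv w a b → eqv w₁ a b

/-- An interpretation of a signature on a frame. -/
structure Interpretation (σ : Signature.{u}) (F : Frame.{u}) where
  cst : σ.Const → F.D
  cst_mem : ∀ c w, cst c ∈ F.dom w
  rel : F.W → (P : σ.Pred) → Set (Fin (σ.arity P) → F.D)
  rel_dom : ∀ w P, ∀ a ∈ rel w P, ∀ i, a i ∈ F.dom w
  rel_le : ∀ w w₁ P, F.le w w₁ → rel w P ⊆ rel w₁ P
  rel_eqv : ∀ w P a b, (∀ i, F.eqv w (a i) (b i)) → a ∈ rel w P → b ∈ rel w P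

variable {σ : Signature.{u}} {F : Frame.{u}}

/-- The denotation of a term relative to an assignment. -/
def Interpretation.den (I : Interpretation σ F) (g : ℕ → F.D) : Term σ → F.D
  | .var x => g x
  | .cst c => I.cst c

/-- Truth of a formula at a world relative to a variable assignment. -/
def Interpretation.Sat (I : Interpretation σ F) : F.W → (ℕ → F.D) → Formula σ → Prop
  | w, g, .atom P t => (fun i => I.den g (t i)) ∈ I.rel w P
  | w, g, .eq s t => F.eqv w (I.den g s) (I.den g t)
  | w, g, .and φ ψ => I.Sat w g φ ∧ I.Sat w g ψ
  | w, g, .or φ ψ => I.Sat w g φ ∨ I.Sat w g ψ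
  | w, g, .imp φ ψ => ∀ w₁, F.le w w₁ → I.Sat w₁ g φ → I.Sat w₁ g ψ
  | w, g, .box φ => ∀ w₁ v, F.le w w₁ → F.M w₁ v → I.Sat v g φ
  | w, g, .dia φ => ∃ v, F.M w v ∧ I.Sat v g φ
  | w, g, .all x φ => ∀ w₁, F.le w w₁ → ∀ a ∈ F.dom w₁, I.Sat w₁ (Function.update g x a) φ
  | w, g, .ex x φ => ∃ a ∈ F.dom w, I.Sat w (Function.update g x a) φ
  | _, _, .bot => False

/-- Truth at a world: truth relative to every assignment into the domain of that world. -/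
def Interpretation.TrueAt (I : Interpretation σ F) (w : F.W) (φ : Formula σ) : Prop :=
  ∀ g : ℕ → F.D, (∀ x, g x ∈ F.dom w) → I.Sat w g φ

/-- Local consequence over a class `C` of frames. -/
def Entails (C : Set Frame.{u}) (Γ : Set (Formula σ)) (φ : Formula σ) : Prop :=
  ∀ F ∈ C, ∀ (I : Interpretation σ F) (w : F.W), (∀ γ ∈ Γ, I.TrueAt w γ) → I.TrueAt w φ

/-- The class of frames whose modal relation is reflexive. -/
def reflexiveFrames : Set Frame.{u} := {F | ∀ w, F.M w w}

end FOFS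

namespace FOFS

open Formula

variable {σ : Signature.{u}}

/-! ## Substitution of constants -/

section Substitution

/-! The proof is by contraposition: a canonical model refutes every underivable sentence. Single
prime theories are awkward as worlds, because the two frame conditions ask that a theory and its
modal neighbours be extended together, with domains growing along both relations. Here whole trees
are built at once. A network is a saturated set of pairs (node, element of the Lindenbaum algebra),
and a world is a node in a network. Going up in the intuitionistic order enlarges the network and
keeps the node. A modal step keeps the network and moves to a child or stays put. Both frame
conditions and reflexivity are then immediate, and staying put is harmless because of `lbox_le` and
`le_ldia`. Equality is evaluated at one world at a time, so substitution in modal-free formulas is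
enough.

The work lies in the labelled derivability relation `Der`, which combines provable implication at
each node with passing `□` to a child and `◇` to a parent. An element may be used at a node only if
its constants are available there: each constant has an owner node, and is available at the owner
and its descendants. Saturation needs five properties: deduction (`Der.himp`), case distinction
(`Der.sup`), `□` through a child without assumptions (`Der.box_intro`), a fresh child as witness for
`◇` (`Der.dia_elim`), and fresh constants for `∃` and `∀` (`Der.ex_elim`,
`Der.exists_of_freshConst`). All are proved by one analysis, `TowerBase.der_induction`: above a
chosen node, what is derivable is described level by level by a tower, and outside that cone an
assumption acts only through its effect `◇t` on the parent. The Fischer Servi axioms make this work: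
`ldia_himp_le` moves information down to the parent, and `ldia_himp_lbox_le` brings it back up. When
a fresh constant must be removed across a change of language, `exists_interpolant` quantifies it
away.

Constants and tree edges carry ranks. A network of rank `n` uses only ranks up to `n`, so rank `n +
1` supplies infinitely many fresh constants at every node and infinitely many fresh children. With
these, `exists_network` saturates any set of rank `n` that does not derive a given goal, and
`sat_iff` is the truth lemma. The signature's own constants serve as witnesses, so sentences are
first renamed by `toRoot` into constants owned by the root. `Thm.of_map` undoes the renaming at the
end. -/

@[simp] theorem isSentence_and {φ ψ : Formula σ} :
    IsSentence (.and φ ψ) ↔ IsSentence φ ∧ IsSentence ψ := Set.union_empty_iff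

@[simp] theorem isSentence_or {φ ψ : Formula σ} :
    IsSentence (.or φ ψ) ↔ IsSentence φ ∧ IsSentence ψ := Set.union_empty_iff

@[simp] theorem isSentence_imp {φ ψ : Formula σ} :
    IsSentence (.imp φ ψ) ↔ IsSentence φ ∧ IsSentence ψ := Set.union_empty_iff

@[simp] theorem isSentence_box {φ : Formula σ} : IsSentence (.box φ) ↔ IsSentence φ := Iff.rfl

@[simp] theorem isSentence_dia {φ : Formula σ} : IsSentence (.dia φ) ↔ IsSentence φ := Iff.rfl

@[simp] theorem isSentence_bot : IsSentence (.bot : Formula σ) := rfl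

@[simp] theorem isSentence_top : IsSentence (Formula.top : Formula σ) :=
  isSentence_imp.2 ⟨isSentence_bot, isSentence_bot⟩

@[simp] theorem isSentence_all {x : ℕ} {φ : Formula σ} :
    IsSentence (.all x φ) ↔ FreeOnly x φ := Set.sdiff_eq_empty

@[simp] theorem isSentence_ex {x : ℕ} {φ : Formula σ} :
    IsSentence (.ex x φ) ↔ FreeOnly x φ := Set.sdiff_eq_empty

/-- The set of constants occurring in a formula. -/
def consts (φ : Formula σ) : Set σ.Const := {c | HasConst c φ}

theorem Term.inst_fv {x y : ℕ} {c : σ.Const} {t : Term σ} (h : t.inst x c = .var y) :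
    t = .var y ∧ y ≠ x := by
  cases t with
  | var z =>
    by_cases hz : z = x
    · simp [Term.inst, hz] at h
    · simp only [Term.inst, hz, if_false, Term.var.injEq] at h
      subst h; exact ⟨rfl, hz⟩
  | cst d => simp [Term.inst] at h

theorem fv_inst (x : ℕ) (c : σ.Const) (φ : Formula σ) : fv (φ.inst x c) ⊆ fv φ \ {x} := by
  induction φ with
  | atom P t => rintro y ⟨i, hi⟩; exact ⟨⟨i, (Term.inst_fv hi).1⟩, (Term.inst_fv hi).2⟩
  | eq s t =>
    rintro y (h | h)
    · exact ⟨Or.inl (Term.inst_fv h).1, (Term.inst_fv h).2⟩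
    · exact ⟨Or.inr (Term.inst_fv h).1, (Term.inst_fv h).2⟩
  | and φ ψ ih1 ih2 | or φ ψ ih1 ih2 | imp φ ψ ih1 ih2 =>
    simp only [Formula.inst, fv, Set.union_sdiff_distrib]; exact Set.union_subset_union ih1 ih2
  | box φ ih | dia φ ih => exact ih
  | all y φ ih | ex y φ ih =>
    by_cases h : y = x
    · subst h; simp [Formula.inst, fv]
    · simp only [Formula.inst, h, if_false, fv]
      intro z hz
      exact ⟨⟨(ih hz.1).1, hz.2⟩, (ih hz.1).2⟩
  | bot => simp [Formula.inst, fv]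

theorem Formula.FreeOnly.inst {x : ℕ} {φ : Formula σ} (h : FreeOnly x φ) (c : σ.Const) :
    IsSentence (φ.inst x c) :=
  Set.subset_eq_empty (fv_inst x c φ) (Set.sdiff_eq_empty.2 h)

theorem Term.inst_const {x : ℕ} {c d : σ.Const} {t : Term σ} (h : t.inst x c = .cst d) :
    d = c ∨ t = .cst d := by
  cases t with
  | var z =>
    by_cases hz : z = x
    · simp [Term.inst, hz] at h; exact Or.inl h.symm
    · simp [Term.inst, hz] at h
  | cst d => right; simpa [Term.inst] using h

theorem hasConst_inst {x : ℕ} {c d : σ.Const} {φ : Formula σ} (h : HasConst d (φ.inst x c)) :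
    d = c ∨ HasConst d φ := by
  induction φ with
  | atom P t => obtain ⟨i, hi⟩ := h; exact (Term.inst_const hi).imp_right fun h => ⟨i, h⟩
  | eq s t =>
    rcases h with h | h
    · exact (Term.inst_const h).imp_right Or.inl
    · exact (Term.inst_const h).imp_right Or.inr
  | and φ ψ ih1 ih2 | or φ ψ ih1 ih2 | imp φ ψ ih1 ih2 =>
    rcases h with h | h
    · exact (ih1 h).imp_right Or.inl
    · exact (ih2 h).imp_right Or.inr
  | box φ ih | dia φ ih => exact ih h
  | all y φ ih | ex y φ ih =>
    by_cases hy : y = x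
    · simp only [Formula.inst, hy, if_true] at h; exact Or.inr h
    · simp only [Formula.inst, hy, if_false] at h; exact ih h
  | bot => exact h.elim

theorem Term.replaceConst_eq_var {x y : ℕ} {c : σ.Const} {t : Term σ}
    (h : t.replaceConst c x = .var y) : t = .var y ∨ y = x := by
  cases t with
  | var z => exact Or.inl h
  | cst d =>
    by_cases hd : d = c
    · simp [Term.replaceConst, hd] at h; exact Or.inr h.symm
    · simp [Term.replaceConst, hd] at h

theorem fv_replaceConst (c : σ.Const) (x : ℕ) (φ : Formula σ) :
    fv (φ.replaceConst c x) ⊆ insert x (fv φ) := by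
  induction φ with
  | atom P t =>
    rintro y ⟨i, hi⟩
    exact (Term.replaceConst_eq_var hi).symm.imp_right fun h => ⟨i, h⟩
  | eq s t =>
    rintro y (h | h)
    · exact (Term.replaceConst_eq_var h).symm.imp_right Or.inl
    · exact (Term.replaceConst_eq_var h).symm.imp_right Or.inr
  | and φ ψ ih1 ih2 | or φ ψ ih1 ih2 | imp φ ψ ih1 ih2 =>
    rintro y (h | h)
    · exact (ih1 h).imp_right Or.inl
    · exact (ih2 h).imp_right Or.inr
  | box φ ih | dia φ ih => exact ih
  | all y φ ih | ex y φ ih =>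
    rintro z ⟨hz, hzy⟩
    exact (ih hz).imp_right fun h => ⟨h, hzy⟩
  | bot => exact Set.empty_subset _

theorem Formula.IsSentence.replaceConst {φ : Formula σ} (h : IsSentence φ) (c : σ.Const) (x : ℕ) :
    FreeOnly x (φ.replaceConst c x) := by
  have := fv_replaceConst c x φ
  rwa [show fv φ = ∅ from h, insert_empty_eq] at this

theorem Term.replaceConst_eq_cst {x : ℕ} {c d : σ.Const} {t : Term σ}
    (h : t.replaceConst c x = .cst d) : d ≠ c ∧ t = .cst d := by
  cases t with
  | var z => simp [Term.replaceConst] at h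
  | cst e =>
    by_cases he : e = c
    · simp [Term.replaceConst, he] at h
    · simp [Term.replaceConst, he] at h; subst h; exact ⟨he, rfl⟩

theorem hasConst_replaceConst {c d : σ.Const} {x : ℕ} {φ : Formula σ}
    (h : HasConst d (φ.replaceConst c x)) : d ≠ c ∧ HasConst d φ := by
  induction φ with
  | atom P t =>
    obtain ⟨i, hi⟩ := h
    exact (Term.replaceConst_eq_cst hi).imp_right fun h => ⟨i, h⟩
  | eq s t =>
    rcases h with h | h
    · exact (Term.replaceConst_eq_cst h).imp_right Or.inl
    · exact (Term.replaceConst_eq_cst h).imp_right Or.inr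
  | and φ ψ ih1 ih2 | or φ ψ ih1 ih2 | imp φ ψ ih1 ih2 =>
    rcases h with h | h
    · exact (ih1 h).imp_right Or.inl
    · exact (ih2 h).imp_right Or.inr
  | box φ ih | dia φ ih | all y φ ih | ex y φ ih => exact ih h
  | bot => exact h.elim

theorem Term.replaceConst_of_ne {c : σ.Const} {t : Term σ} (h : t ≠ .cst c) (x : ℕ) :
    t.replaceConst c x = t := by
  cases t with
  | var z => rfl
  | cst d => simp only [ne_eq, Term.cst.injEq] at h; simp [Term.replaceConst, h]

theorem replaceConst_of_not_hasConst {c : σ.Const} {φ : Formula σ} (h : ¬ HasConst c φ) (x : ℕ) :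
    φ.replaceConst c x = φ := by
  induction φ with
  | atom P t =>
    simp only [HasConst, not_exists] at h
    simp only [Formula.replaceConst]
    congr 1; funext i; exact Term.replaceConst_of_ne (h i) x
  | eq s t =>
    simp only [HasConst, not_or] at h
    simp [Formula.replaceConst, Term.replaceConst_of_ne h.1, Term.replaceConst_of_ne h.2]
  | and φ ψ ih1 ih2 | or φ ψ ih1 ih2 | imp φ ψ ih1 ih2 =>
    simp only [HasConst, not_or] at h
    simp [Formula.replaceConst, ih1 h.1, ih2 h.2]
  | box φ ih | dia φ ih | all y φ ih | ex y φ ih =>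
    simp only [HasConst] at h
    simp [Formula.replaceConst, ih h]
  | bot => rfl

theorem Term.replaceConst_inst {c : σ.Const} {t : Term σ} (h : t ≠ .cst c) (x : ℕ) :
    (t.inst x c).replaceConst c x = t := by
  cases t with
  | var z => by_cases hz : z = x <;> simp [Term.inst, Term.replaceConst, hz]
  | cst d => simp only [ne_eq, Term.cst.injEq] at h; simp [Term.inst, Term.replaceConst, h]

theorem replaceConst_inst {c : σ.Const} {φ : Formula σ} (h : ¬ HasConst c φ) (x : ℕ) :
    (φ.inst x c).replaceConst c x = φ := by
  induction φ with
  | atom P t =>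
    simp only [HasConst, not_exists] at h
    simp only [Formula.inst, Formula.replaceConst]
    congr 1; funext i; exact Term.replaceConst_inst (h i) x
  | eq s t =>
    simp only [HasConst, not_or] at h
    simp [Formula.inst, Formula.replaceConst, Term.replaceConst_inst h.1,
      Term.replaceConst_inst h.2]
  | and φ ψ ih1 ih2 | or φ ψ ih1 ih2 | imp φ ψ ih1 ih2 =>
    simp only [HasConst, not_or] at h
    simp [Formula.inst, Formula.replaceConst, ih1 h.1, ih2 h.2]
  | box φ ih | dia φ ih =>
    simp only [HasConst] at h
    simp [Formula.inst, Formula.replaceConst, ih h]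
  | all y φ ih | ex y φ ih =>
    by_cases hy : y = x
    · subst hy
      simp only [Formula.inst, if_true]
      exact replaceConst_of_not_hasConst h y
    · simp only [HasConst] at h
      simp [Formula.inst, Formula.replaceConst, hy, ih h]
  | bot => rfl

theorem substitutable_of_not_hasConst {c : σ.Const} {φ : Formula σ} (h : ¬ HasConst c φ) (x : ℕ) :
    Substitutable x c φ := by
  induction φ with
  | atom P t | eq s t | bot => trivial
  | and φ ψ ih1 ih2 | or φ ψ ih1 ih2 | imp φ ψ ih1 ih2 =>
    simp only [HasConst, not_or] at h
    exact ⟨ih1 h.1, ih2 h.2⟩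
  | box φ ih | dia φ ih => exact ih h
  | all y φ ih | ex y φ ih => exact ⟨fun h' => (h h').elim, ih h⟩

theorem substitutable_inst {c : σ.Const} {φ : Formula σ} (h : ¬ HasConst c φ) (x : ℕ) :
    Substitutable x c (φ.inst x c) := by
  induction φ with
  | atom P t | eq s t | bot => trivial
  | and φ ψ ih1 ih2 | or φ ψ ih1 ih2 | imp φ ψ ih1 ih2 =>
    simp only [HasConst, not_or] at h
    exact ⟨ih1 h.1, ih2 h.2⟩
  | box φ ih | dia φ ih => exact ih h
  | all y φ ih | ex y φ ih =>
    by_cases hy : y = x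
    · subst hy
      simp only [Formula.inst, if_true]
      exact ⟨fun h' => (h h').elim,
        substitutable_of_not_hasConst (φ := φ) (fun h' => h h') y⟩
    · simp only [Formula.inst, hy, if_false]
      exact ⟨fun _ => hy, ih h⟩

/-- Every variable beyond all the bound ones will do. This provides the variable used when a
constant is quantified away. -/
theorem exists_substitutable (c : σ.Const) (φ : Formula σ) :
    ∃ n, ∀ x, n ≤ x → Substitutable x c φ := by
  induction φ with
  | atom P t | eq s t | bot => exact ⟨0, fun _ _ => trivial⟩
  | and φ ψ ih1 ih2 | or φ ψ ih1 ih2 | imp φ ψ ih1 ih2 =>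
    obtain ⟨n, hn⟩ := ih1
    obtain ⟨m, hm⟩ := ih2
    exact ⟨max n m, fun x hx => ⟨hn x (by omega), hm x (by omega)⟩⟩
  | box φ ih | dia φ ih => exact ih
  | all y φ ih | ex y φ ih =>
    obtain ⟨n, hn⟩ := ih
    exact ⟨max n (y + 1), fun x hx => ⟨fun _ => by omega, hn x (by omega)⟩⟩

theorem Term.inst_replaceConst {x : ℕ} {t : Term σ} (h : t ≠ .var x) (c : σ.Const) :
    (t.replaceConst c x).inst x c = t := by
  cases t with
  | var z => simp only [ne_eq, Term.var.injEq] at h; simp [Term.inst, Term.replaceConst, h]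
  | cst d => by_cases hd : d = c <;> simp [Term.inst, Term.replaceConst, hd]

theorem inst_replaceConst {x : ℕ} {c : σ.Const} {φ : Formula σ} (hx : x ∉ fv φ)
    (h : Substitutable x c φ) : (φ.replaceConst c x).inst x c = φ := by
  induction φ with
  | atom P t =>
    simp only [fv, Set.mem_ofPred_eq, not_exists] at hx
    simp only [Formula.inst, Formula.replaceConst]
    congr 1; funext i; exact Term.inst_replaceConst (hx i) c
  | eq s t =>
    simp only [fv, Set.mem_ofPred_eq, not_or] at hx
    simp [Formula.inst, Formula.replaceConst, Term.inst_replaceConst hx.1,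
      Term.inst_replaceConst hx.2]
  | and φ ψ ih1 ih2 | or φ ψ ih1 ih2 | imp φ ψ ih1 ih2 =>
    simp only [fv, Set.mem_union, not_or] at hx
    simp [Formula.inst, Formula.replaceConst, ih1 hx.1 h.1, ih2 hx.2 h.2]
  | box φ ih | dia φ ih =>
    simp [Formula.inst, Formula.replaceConst, ih hx h]
  | all y φ ih | ex y φ ih =>
    by_cases hy : y = x
    · have hc : ¬ HasConst c φ := fun hc => h.1 hc hy
      simp [Formula.inst, Formula.replaceConst, hy, replaceConst_of_not_hasConst hc]
    · have hx' : x ∉ fv φ := fun hx' => hx ⟨hx', fun e => hy (Set.mem_singleton_iff.1 e).symm⟩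
      simp [Formula.inst, Formula.replaceConst, hy, ih hx' h.2]
  | bot => rfl

theorem finite_consts (φ : Formula σ) : (consts φ).Finite := by
  induction φ with
  | atom P t =>
    refine (Set.finite_iUnion fun i => ?_ : (⋃ i, {c | t i = Term.cst c}).Finite).subset
      fun c ⟨i, hi⟩ => Set.mem_iUnion.2 ⟨i, hi⟩
    exact Set.Subsingleton.finite fun c hc d hd => by
      simpa using hc.symm.trans hd
  | eq s t =>
    have h : ∀ t : Term σ, {c | t = Term.cst c}.Finite := fun t =>
      Set.Subsingleton.finite fun c hc d hd => by simpa using hc.symm.trans hd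
    exact (h s).union (h t)
  | and φ ψ ih1 ih2 | or φ ψ ih1 ih2 | imp φ ψ ih1 ih2 => exact ih1.union ih2
  | box φ ih | dia φ ih | all y φ ih | ex y φ ih => exact ih
  | bot => exact Set.finite_empty

end Substitution

/-! ## Renaming constants and closing formulas -/

section Renaming

/-- Rename the constants of a term along `ρ`. -/
def Term.map (ρ : σ.Const → σ.Const) : Term σ → Term σ
  | var x => var x
  | cst c => cst (ρ c)

/-- Rename the constants of a formula along `ρ`. -/
def Formula.map (ρ : σ.Const → σ.Const) : Formula σ → Formula σ
  | atom P t => atom P fun i => (t i).map ρ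
  | eq s t => eq (s.map ρ) (t.map ρ)
  | and φ ψ => and (map ρ φ) (map ρ ψ)
  | or φ ψ => or (map ρ φ) (map ρ ψ)
  | imp φ ψ => imp (map ρ φ) (map ρ ψ)
  | box φ => box (map ρ φ)
  | dia φ => dia (map ρ φ)
  | all x φ => all x (map ρ φ)
  | ex x φ => ex x (map ρ φ)
  | bot => bot

/-- Rename constants along `ρ` and replace the variables in the domain of `s` by constants. -/
def Term.close (ρ : σ.Const → σ.Const) (s : ℕ → Option σ.Const) : Term σ → Term σ
  | var x => (s x).elim (var x) cst
  | cst c => cst (ρ c)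

/-- Rename constants along `ρ` and replace the free variables in the domain of `s` by constants. -/
def Formula.close (ρ : σ.Const → σ.Const) : (ℕ → Option σ.Const) → Formula σ → Formula σ
  | s, atom P t => atom P fun i => (t i).close ρ s
  | s, eq t u => eq (t.close ρ s) (u.close ρ s)
  | s, and φ ψ => and (close ρ s φ) (close ρ s ψ)
  | s, or φ ψ => or (close ρ s φ) (close ρ s ψ)
  | s, imp φ ψ => imp (close ρ s φ) (close ρ s ψ)
  | s, box φ => box (close ρ s φ)
  | s, dia φ => dia (close ρ s φ)
  | s, all x φ => all x (close ρ (Function.update s x none) φ)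
  | s, ex x φ => ex x (close ρ (Function.update s x none) φ)
  | _, bot => bot

theorem Term.inst_close (ρ : σ.Const → σ.Const) {s : ℕ → Option σ.Const} {x : ℕ}
    (hx : s x = none) (c : σ.Const) (t : Term σ) :
    (t.close ρ s).inst x c = t.close ρ (Function.update s x (some c)) := by
  cases t with
  | var y =>
    by_cases hy : y = x
    · subst hy; simp [Term.close, hx, Term.inst]
    · rcases h : s y with _ | d <;> simp [Term.close, h, Term.inst, hy]
  | cst d => rfl

theorem inst_close (ρ : σ.Const → σ.Const) {s : ℕ → Option σ.Const} {x : ℕ}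
    (hx : s x = none) (c : σ.Const) (φ : Formula σ) :
    (φ.close ρ s).inst x c = φ.close ρ (Function.update s x (some c)) := by
  induction φ generalizing s with
  | atom P t => simp [Formula.close, Formula.inst, Term.inst_close ρ hx]
  | eq t u => simp [Formula.close, Formula.inst, Term.inst_close ρ hx]
  | and φ ψ ih1 ih2 | or φ ψ ih1 ih2 | imp φ ψ ih1 ih2 =>
    simp [Formula.close, Formula.inst, ih1 hx, ih2 hx]
  | box φ ih | dia φ ih => simp [Formula.close, Formula.inst, ih hx]
  | all y φ ih | ex y φ ih =>
    by_cases hy : y = x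
    · subst hy; simp [Formula.close, Formula.inst]
    · have : Function.update s y none x = none := by simp [Function.update, hx]
      simp only [Formula.close, Formula.inst, hy, if_false, ih this]
      rw [Function.update_comm hy]
  | bot => rfl

theorem Term.close_eq_var {ρ : σ.Const → σ.Const} {s : ℕ → Option σ.Const} {x : ℕ} {t : Term σ}
    (h : t.close ρ s = .var x) : t = .var x ∧ s x = none := by
  cases t with
  | var y =>
    rcases hy : s y with _ | d
    · simp only [Term.close, hy, Option.elim, Term.var.injEq] at h
      subst h; exact ⟨rfl, hy⟩
    · simp [Term.close, hy] at h
  | cst d => simp [Term.close] at h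

theorem fv_close (ρ : σ.Const → σ.Const) (s : ℕ → Option σ.Const) (φ : Formula σ) :
    fv (φ.close ρ s) ⊆ {x | x ∈ fv φ ∧ s x = none} := by
  induction φ generalizing s with
  | atom P t => rintro x ⟨i, hi⟩; exact (Term.close_eq_var hi).imp_left fun h => ⟨i, h⟩
  | eq t u =>
    rintro x (h | h)
    · exact (Term.close_eq_var h).imp_left Or.inl
    · exact (Term.close_eq_var h).imp_left Or.inr
  | and φ ψ ih1 ih2 | or φ ψ ih1 ih2 | imp φ ψ ih1 ih2 =>
    rintro x (h | h)
    · exact (ih1 s h).imp_left Or.inl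
    · exact (ih2 s h).imp_left Or.inr
  | box φ ih | dia φ ih => exact ih s
  | all y φ ih | ex y φ ih =>
    rintro x ⟨hx, hxy⟩
    obtain ⟨h1, h2⟩ := ih _ hx
    have hxy' : x ≠ y := hxy
    exact ⟨⟨h1, hxy⟩, by simpa [Function.update, hxy'] using h2⟩
  | bot => exact Set.empty_subset _

theorem isSentence_close (ρ : σ.Const → σ.Const) (g : ℕ → σ.Const) (φ : Formula σ) :
    IsSentence (φ.close ρ fun x => some (g x)) :=
  Set.eq_empty_of_forall_notMem fun x hx => by simpa using (fv_close ρ _ φ hx).2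

theorem freeOnly_close (ρ : σ.Const → σ.Const) (g : ℕ → σ.Const) (x : ℕ) (φ : Formula σ) :
    FreeOnly x (φ.close ρ (Function.update (fun x => some (g x)) x none)) := fun y hy => by
  by_contra h
  have h' : y ≠ x := h
  simpa [Function.update, h'] using (fv_close ρ _ φ hy).2

theorem Term.close_eq_cst {ρ : σ.Const → σ.Const} {s : ℕ → Option σ.Const} {d : σ.Const}
    {t : Term σ} (h : t.close ρ s = .cst d) : (∃ c, d = ρ c) ∨ ∃ x, s x = some d := by
  cases t with
  | var y =>
    rcases hy : s y with _ | e
    · simp [Term.close, hy] at h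
    · simp only [Term.close, hy, Option.elim, Term.cst.injEq] at h
      subst h; exact Or.inr ⟨y, hy⟩
  | cst c => simp only [Term.close, Term.cst.injEq] at h; exact Or.inl ⟨c, h.symm⟩

theorem hasConst_close {ρ : σ.Const → σ.Const} {s : ℕ → Option σ.Const} {d : σ.Const}
    {φ : Formula σ} (h : HasConst d (φ.close ρ s)) : (∃ c, d = ρ c) ∨ ∃ x, s x = some d := by
  induction φ generalizing s with
  | atom P t => obtain ⟨i, hi⟩ := h; exact Term.close_eq_cst hi
  | eq t u => exact h.elim Term.close_eq_cst Term.close_eq_cst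
  | and φ ψ ih1 ih2 | or φ ψ ih1 ih2 | imp φ ψ ih1 ih2 => exact h.elim ih1 ih2
  | box φ ih | dia φ ih => exact ih h
  | all y φ ih | ex y φ ih =>
    refine (ih h).imp_right fun ⟨x, hx⟩ => ⟨x, ?_⟩
    by_cases hy : x = y
    · simp [hy] at hx
    · simpa [Function.update, hy] using hx
  | bot => exact h.elim

theorem close_eq_map (ρ : σ.Const → σ.Const) {s : ℕ → Option σ.Const} {φ : Formula σ}
    (h : ∀ x ∈ fv φ, s x = none) : φ.close ρ s = φ.map ρ := by
  have ht : ∀ (s : ℕ → Option σ.Const) (t : Term σ), (∀ x, t = .var x → s x = none) →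
      t.close ρ s = t.map ρ := by
    rintro s (x | c) h
    · simp [Term.close, Term.map, h x rfl]
    · rfl
  induction φ generalizing s with
  | atom P t =>
    simp only [Formula.close, Formula.map]
    congr 1; funext i; exact ht _ _ fun x hx => h x ⟨i, hx⟩
  | eq t u =>
    simp only [Formula.close, Formula.map]
    rw [ht _ t fun x hx => h x (Or.inl hx), ht _ u fun x hx => h x (Or.inr hx)]
  | and φ ψ ih1 ih2 | or φ ψ ih1 ih2 | imp φ ψ ih1 ih2 =>
    simp only [Formula.close, Formula.map]
    rw [ih1 fun x hx => h x (Or.inl hx), ih2 fun x hx => h x (Or.inr hx)]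
  | box φ ih | dia φ ih =>
    simp only [Formula.close, Formula.map]
    rw [ih h]
  | all y φ ih | ex y φ ih =>
    simp only [Formula.close, Formula.map]
    rw [ih]
    intro x hx
    by_cases hy : x = y
    · simp [hy]
    · simpa [Function.update, hy] using h x ⟨hx, hy⟩
  | bot => rfl

theorem Formula.IsSentence.close_eq_map {φ : Formula σ} (h : IsSentence φ) (ρ : σ.Const → σ.Const)
    (s : ℕ → Option σ.Const) : φ.close ρ s = φ.map ρ :=
  FOFS.close_eq_map ρ fun x hx => by rw [show fv φ = ∅ from h] at hx; exact hx.elim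

theorem fv_map (ρ : σ.Const → σ.Const) (φ : Formula σ) : fv (φ.map ρ) = fv φ := by
  have ht : ∀ (t : Term σ) x, t.map ρ = .var x ↔ t = .var x := by
    rintro (y | c) x <;> simp [Term.map]
  induction φ with
  | atom P t => simp [Formula.map, fv, ht]
  | eq t u => simp [Formula.map, fv, ht]
  | and φ ψ ih1 ih2 | or φ ψ ih1 ih2 | imp φ ψ ih1 ih2 => simp [Formula.map, fv, ih1, ih2]
  | box φ ih | dia φ ih | all y φ ih | ex y φ ih => simp [Formula.map, fv, ih]
  | bot => rfl

theorem isSentence_map {ρ : σ.Const → σ.Const} {φ : Formula σ} :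
    IsSentence (φ.map ρ) ↔ IsSentence φ := by rw [IsSentence, fv_map, IsSentence]

theorem freeOnly_map {ρ : σ.Const → σ.Const} {x : ℕ} {φ : Formula σ} :
    FreeOnly x (φ.map ρ) ↔ FreeOnly x φ := by rw [FreeOnly, fv_map, FreeOnly]

theorem map_eq_self {ρ : σ.Const → σ.Const} {φ : Formula σ} (h : ∀ c, HasConst c φ → ρ c = c) :
    φ.map ρ = φ := by
  have ht : ∀ t : Term σ, (∀ c, t = .cst c → ρ c = c) → t.map ρ = t := by
    rintro (x | c) h
    · rfl
    · simp [Term.map, h c rfl]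
  induction φ with
  | atom P t =>
    simp only [Formula.map]
    congr 1; funext i; exact ht _ fun c hc => h c ⟨i, hc⟩
  | eq t u =>
    simp only [Formula.map]
    rw [ht t fun c hc => h c (Or.inl hc), ht u fun c hc => h c (Or.inr hc)]
  | and φ ψ ih1 ih2 | or φ ψ ih1 ih2 | imp φ ψ ih1 ih2 =>
    simp only [Formula.map]
    rw [ih1 fun c hc => h c (Or.inl hc), ih2 fun c hc => h c (Or.inr hc)]
  | box φ ih | dia φ ih | all y φ ih | ex y φ ih =>
    simp only [Formula.map]
    rw [ih h]
  | bot => rfl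

theorem map_map (π ρ : σ.Const → σ.Const) (φ : Formula σ) :
    (φ.map ρ).map π = φ.map (π ∘ ρ) := by
  have ht : ∀ t : Term σ, (t.map ρ).map π = t.map (π ∘ ρ) := by rintro (x | c) <;> rfl
  induction φ with
  | atom P t => simp [Formula.map, ht]
  | eq t u => simp [Formula.map, ht]
  | and φ ψ ih1 ih2 | or φ ψ ih1 ih2 | imp φ ψ ih1 ih2 => simp [Formula.map, ih1, ih2]
  | box φ ih | dia φ ih | all y φ ih | ex y φ ih => simp [Formula.map, ih]
  | bot => rfl

theorem map_inst (ρ : σ.Const → σ.Const) (x : ℕ) (c : σ.Const) (φ : Formula σ) :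
    (φ.inst x c).map ρ = (φ.map ρ).inst x (ρ c) := by
  have ht : ∀ t : Term σ, (t.inst x c).map ρ = (t.map ρ).inst x (ρ c) := by
    rintro (y | d)
    · by_cases hy : y = x <;> simp [Term.inst, Term.map, hy]
    · rfl
  induction φ with
  | atom P t => simp [Formula.map, Formula.inst, ht]
  | eq t u => simp [Formula.map, Formula.inst, ht]
  | and φ ψ ih1 ih2 | or φ ψ ih1 ih2 | imp φ ψ ih1 ih2 =>
    simp [Formula.map, Formula.inst, ih1, ih2]
  | box φ ih | dia φ ih => simp [Formula.map, Formula.inst, ih]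
  | all y φ ih | ex y φ ih =>
    by_cases hy : y = x <;> simp [Formula.map, Formula.inst, ih, hy]
  | bot => rfl

theorem map_replaceConst {ρ : σ.Const → σ.Const} (hρ : Function.Injective ρ) (x : ℕ)
    (c : σ.Const) (φ : Formula σ) :
    (φ.replaceConst c x).map ρ = (φ.map ρ).replaceConst (ρ c) x := by
  have ht : ∀ t : Term σ, (t.replaceConst c x).map ρ = (t.map ρ).replaceConst (ρ c) x := by
    rintro (y | d)
    · rfl
    · by_cases hd : d = c <;> simp [Term.replaceConst, Term.map, hρ.eq_iff, hd]
  induction φ with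
  | atom P t => simp [Formula.map, Formula.replaceConst, ht]
  | eq t u => simp [Formula.map, Formula.replaceConst, ht]
  | and φ ψ ih1 ih2 | or φ ψ ih1 ih2 | imp φ ψ ih1 ih2 =>
    simp [Formula.map, Formula.replaceConst, ih1, ih2]
  | box φ ih | dia φ ih | all y φ ih | ex y φ ih => simp [Formula.map, Formula.replaceConst, ih]
  | bot => rfl

theorem hasConst_map {ρ : σ.Const → σ.Const} (hρ : Function.Injective ρ) {c : σ.Const}
    {φ : Formula σ} (h : HasConst (ρ c) (φ.map ρ)) : HasConst c φ := by
  have ht : ∀ t : Term σ, t.map ρ = .cst (ρ c) → t = .cst c := by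
    rintro (x | d) h
    · simp [Term.map] at h
    · simpa [Term.map, hρ.eq_iff] using h
  induction φ with
  | atom P t => obtain ⟨i, hi⟩ := h; exact ⟨i, ht _ hi⟩
  | eq t u => exact h.imp (ht _) (ht _)
  | and φ ψ ih1 ih2 | or φ ψ ih1 ih2 | imp φ ψ ih1 ih2 => exact h.imp ih1 ih2
  | box φ ih | dia φ ih | all y φ ih | ex y φ ih => exact ih h
  | bot => exact h.elim

theorem substitutable_map {ρ : σ.Const → σ.Const} (hρ : Function.Injective ρ) {x : ℕ}
    {c : σ.Const} {φ : Formula σ} (h : Substitutable x c φ) :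
    Substitutable x (ρ c) (φ.map ρ) := by
  induction φ with
  | atom P t | eq t u | bot => trivial
  | and φ ψ ih1 ih2 | or φ ψ ih1 ih2 | imp φ ψ ih1 ih2 => exact ⟨ih1 h.1, ih2 h.2⟩
  | box φ ih | dia φ ih => exact ih h
  | all y φ ih | ex y φ ih => exact ⟨fun h' => h.1 (hasConst_map hρ h'), ih h.2⟩

theorem modalFree_map {ρ : σ.Const → σ.Const} {φ : Formula σ} (h : ModalFree φ) :
    ModalFree (φ.map ρ) := by
  induction φ with
  | atom P t | eq t u | bot => trivial
  | and φ ψ ih1 ih2 | or φ ψ ih1 ih2 | imp φ ψ ih1 ih2 => exact ⟨ih1 h.1, ih2 h.2⟩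
  | box φ ih | dia φ ih => exact h.elim
  | all y φ ih | ex y φ ih => exact ih h

theorem map_subst (ρ : σ.Const → σ.Const) (f : ℕ → Formula σ) (A : PropForm) :
    (A.subst f).map ρ = A.subst fun p => (f p).map ρ := by
  induction A with
  | atom p => rfl
  | bot => rfl
  | and A B ih1 ih2 | or A B ih1 ih2 | imp A B ih1 ih2 =>
    simp [PropForm.subst, Formula.map, ih1, ih2]

/-- The theorems of the logic are closed under injective renamings of constants. -/
theorem Thm.map {ρ : σ.Const → σ.Const} (hρ : Function.Injective ρ) {φ : Formula σ}
    (h : Thm (axiomsT σ) φ) : Thm (axiomsT σ) (φ.map ρ) := by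
  induction h with
  | ax h =>
    obtain ⟨φ, hφ, rfl | rfl⟩ := h
    · exact .ax ⟨φ.map ρ, isSentence_map.2 hφ, Or.inl rfl⟩
    · exact .ax ⟨φ.map ρ, isSentence_map.2 hφ, Or.inr rfl⟩
  | int f hA hf => rw [map_subst]; exact .int _ hA fun p => isSentence_map.2 (hf p)
  | box_and h1 h2 => exact .box_and (isSentence_map.2 h1) (isSentence_map.2 h2)
  | box_top => exact .box_top
  | dia_or h1 h2 => exact .dia_or (isSentence_map.2 h1) (isSentence_map.2 h2)
  | dia_bot => exact .dia_bot
  | fs1 h1 h2 => exact .fs1 (isSentence_map.2 h1) (isSentence_map.2 h2)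
  | fs2 h1 h2 => exact .fs2 (isSentence_map.2 h1) (isSentence_map.2 h2)
  | univ x c h =>
    simp only [Formula.map, map_inst]
    exact .univ x _ (freeOnly_map.2 h)
  | exist x c h =>
    simp only [Formula.map, map_inst]
    exact .exist x _ (freeOnly_map.2 h)
  | all_ant x h1 h2 => exact .all_ant x (freeOnly_map.2 h1) (isSentence_map.2 h2)
  | all_con x h1 h2 => exact .all_con x (isSentence_map.2 h1) (freeOnly_map.2 h2)
  | id_ref c => exact .id_ref _
  | id_sub x c d h1 h2 =>
    simp only [Formula.map, map_inst]
    exact .id_sub x _ _ (freeOnly_map.2 h1) (modalFree_map h2)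
  | mp _ _ ih1 ih2 => exact .mp ih1 ih2
  | gen x c _ h ih =>
    simp only [Formula.map, map_replaceConst hρ]
    exact .gen x _ ih (substitutable_map hρ h)
  | reg_box _ ih => exact .reg_box ih
  | reg_dia _ ih => exact .reg_dia ih

/-- A formula is a theorem if its image under some injective renaming of constants is one. -/
theorem Thm.of_map {ρ : σ.Const → σ.Const} (hρ : Function.Injective ρ) {φ : Formula σ}
    (h : Thm (axiomsT σ) (φ.map ρ)) : Thm (axiomsT σ) φ := by
  -- Only finitely many constants occur in `φ`, so the inverse of `ρ` on their images is a finite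
  -- partial injection, and this extends to a permutation even if `ρ` is not surjective.
  obtain ⟨π, hπ⟩ : ∃ π : Equiv.Perm σ.Const, ∀ c ∈ consts φ, π (ρ c) = c := by
    classical
    let K : Set σ.Const := consts φ ∪ ρ '' consts φ
    have hK : K.Finite := (finite_consts φ).union ((finite_consts φ).image ρ)
    have : Finite K := hK
    let f : {c : K // c.1 ∈ consts φ} → {c : K // c.1 ∈ ρ '' consts φ} := fun c =>
      ⟨⟨ρ c, Or.inr ⟨c, c.2, rfl⟩⟩, c, c.2, rfl⟩
    have hf : Function.Bijective f := by
      refine ⟨fun c d h => ?_, ?_⟩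
      · have : ρ c = ρ d := congrArg (fun e => e.1.1) h
        exact Subtype.ext (Subtype.ext (hρ this))
      · rintro ⟨d, c, hc, hcd⟩
        exact ⟨⟨⟨c, Or.inl hc⟩, hc⟩, Subtype.ext (Subtype.ext hcd)⟩
    let e := (Equiv.ofBijective f hf).symm
    refine ⟨Equiv.Perm.ofSubtype e.extendSubtype, fun c hc => ?_⟩
    have hc' : ρ c ∈ K := Or.inr ⟨c, hc, rfl⟩
    rw [Equiv.Perm.ofSubtype_apply_of_mem _ hc',
      Equiv.extendSubtype_apply_of_mem e ⟨ρ c, hc'⟩ ⟨c, hc, rfl⟩]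
    have : e ⟨⟨ρ c, hc'⟩, c, hc, rfl⟩ = ⟨⟨c, Or.inl hc⟩, hc⟩ := by
      rw [Equiv.symm_apply_eq]; rfl
    rw [this]
  have := h.map π.injective
  rw [map_map] at this
  rwa [map_eq_self (ρ := π ∘ ρ) hπ] at this

end Renaming

/-! ## The Lindenbaum algebra -/

section Lindenbaum

/-- The substitution used to instantiate propositional schemes in up to three letters. -/
def assign₃ (φ ψ χ : Formula σ) : ℕ → Formula σ
  | 0 => φ
  | 1 => ψ
  | _ => χ

theorem isSentence_assign₃ {φ ψ χ : Formula σ} (hφ : IsSentence φ) (hψ : IsSentence ψ)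
    (hχ : IsSentence χ) : ∀ p, IsSentence (assign₃ φ ψ χ p)
  | 0 => hφ
  | 1 => hψ
  | _ + 2 => hχ

/-- The type of sentences. -/
def Sentence (σ : Signature.{u}) : Type u := {φ : Formula σ // IsSentence φ}

namespace Sentence

/-- Provable implication. -/
def Le (φ ψ : Sentence σ) : Prop := Thm (axiomsT σ) (.imp φ.1 ψ.1)

variable {φ ψ χ : Sentence σ}

theorem int₃ {A : PropForm} (h : IPC A) (φ ψ χ : Sentence σ) :
    Thm (axiomsT σ) (A.subst (assign₃ φ.1 ψ.1 χ.1)) :=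
  .int _ h (isSentence_assign₃ φ.2 ψ.2 χ.2)

theorem k (φ ψ : Sentence σ) : Thm (axiomsT σ) (.imp φ.1 (.imp ψ.1 φ.1)) :=
  int₃ (IPC.k (.atom 0) (.atom 1)) φ ψ ψ

theorem Le.weaken (h : Thm (axiomsT σ) φ.1) (ψ : Sentence σ) : Le ψ φ := .mp (k φ ψ) h

theorem s (φ ψ χ : Sentence σ) : Thm (axiomsT σ)
    (.imp (.imp φ.1 (.imp ψ.1 χ.1)) (.imp (.imp φ.1 ψ.1) (.imp φ.1 χ.1))) :=
  int₃ (IPC.s (.atom 0) (.atom 1) (.atom 2)) φ ψ χ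

theorem le_mp (h : Thm (axiomsT σ) (.imp φ.1 (.imp ψ.1 χ.1))) (h' : Le φ ψ) : Le φ χ :=
  .mp (.mp (s φ ψ χ) h) h'

theorem Le.trans (h : Le φ ψ) (h' : Le ψ χ) : Le φ χ :=
  le_mp (Le.weaken (φ := ⟨.imp ψ.1 χ.1, isSentence_imp.2 ⟨ψ.2, χ.2⟩⟩) h' φ) h

theorem Le.refl (φ : Sentence σ) : Le φ φ :=
  le_mp (ψ := ⟨.imp φ.1 φ.1, isSentence_imp.2 ⟨φ.2, φ.2⟩⟩)
    (k φ ⟨.imp φ.1 φ.1, isSentence_imp.2 ⟨φ.2, φ.2⟩⟩) (k φ φ)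

instance : Preorder (Sentence σ) where
  le := Le
  le_refl := Le.refl
  le_trans _ _ _ := Le.trans

instance : Min (Sentence σ) := ⟨fun φ ψ => ⟨.and φ.1 ψ.1, isSentence_and.2 ⟨φ.2, ψ.2⟩⟩⟩
instance : Max (Sentence σ) := ⟨fun φ ψ => ⟨.or φ.1 ψ.1, isSentence_or.2 ⟨φ.2, ψ.2⟩⟩⟩
instance : HImp (Sentence σ) := ⟨fun φ ψ => ⟨.imp φ.1 ψ.1, isSentence_imp.2 ⟨φ.2, ψ.2⟩⟩⟩
instance : Bot (Sentence σ) := ⟨⟨.bot, isSentence_bot⟩⟩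
instance : Top (Sentence σ) := ⟨⟨.top, isSentence_top⟩⟩

theorem inf_le_left : φ ⊓ ψ ≤ φ := int₃ (IPC.and_left (.atom 0) (.atom 1)) φ ψ ψ
theorem inf_le_right : φ ⊓ ψ ≤ ψ := int₃ (IPC.and_right (.atom 0) (.atom 1)) φ ψ ψ

theorem le_inf (h₁ : φ ≤ ψ) (h₂ : φ ≤ χ) : φ ≤ ψ ⊓ χ :=
  le_mp (Le.trans (ψ := ψ) (χ := χ ⇨ (ψ ⊓ χ)) h₁
    (int₃ (IPC.and_intro (.atom 0) (.atom 1)) ψ χ χ)) h₂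

theorem le_sup_left : φ ≤ φ ⊔ ψ := int₃ (IPC.or_left (.atom 0) (.atom 1)) φ ψ ψ
theorem le_sup_right : ψ ≤ φ ⊔ ψ := int₃ (IPC.or_right (.atom 0) (.atom 1)) φ ψ ψ

theorem sup_le (h₁ : φ ≤ χ) (h₂ : ψ ≤ χ) : φ ⊔ ψ ≤ χ :=
  .mp (.mp (int₃ (IPC.or_elim (.atom 0) (.atom 1) (.atom 2)) φ ψ χ) h₁) h₂

theorem bot_le : ⊥ ≤ φ := int₃ (IPC.efq (.atom 0)) φ φ φ

theorem le_top : φ ≤ ⊤ := Le.weaken (φ := ⊤) (Le.refl ⊥) φ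

theorem le_himp_iff : φ ≤ ψ ⇨ χ ↔ φ ⊓ ψ ≤ χ := by
  constructor
  · intro h
    exact le_mp (Le.trans inf_le_left h) inf_le_right
  · intro h
    have h1 : φ ≤ ψ ⇨ (φ ⊓ ψ) := int₃ (IPC.and_intro (.atom 0) (.atom 1)) φ ψ ψ
    exact h1.trans (le_mp (χ := ψ ⇨ χ) (φ := ψ ⇨ (φ ⊓ ψ)) (ψ := ψ ⇨ (φ ⊓ ψ))
      (Le.weaken (φ := (ψ ⇨ (φ ⊓ ψ)) ⇨ (ψ ⇨ χ))
        (.mp (s ψ (φ ⊓ ψ) χ) (Le.weaken (φ := (φ ⊓ ψ) ⇨ χ) h ψ)) _) (Le.refl _))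

theorem le_of_thm (h : Thm (axiomsT σ) φ.1) : ψ ≤ φ := Le.weaken h ψ

end Sentence

/-- The Lindenbaum algebra: sentences modulo provable equivalence. -/
def LT (σ : Signature.{u}) : Type u := Antisymmetrization (Sentence σ) (· ≤ ·)

instance : PartialOrder (LT σ) := inferInstanceAs (PartialOrder (Antisymmetrization _ _))

/-- The class of a sentence. -/
def cls (φ : Formula σ) (h : IsSentence φ) : LT σ :=
  toAntisymmetrization (α := Sentence σ) (· ≤ ·) ⟨φ, h⟩

theorem cls_le {φ ψ : Formula σ} {hφ : IsSentence φ} {hψ : IsSentence ψ} :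
    cls φ hφ ≤ cls ψ hψ ↔ Thm (axiomsT σ) (.imp φ ψ) :=
  toAntisymmetrization_le_toAntisymmetrization_iff

theorem Sentence.inf_mono {a b c d : Sentence σ} (h : a ≤ b) (h' : c ≤ d) : a ⊓ c ≤ b ⊓ d :=
  Sentence.le_inf (Sentence.inf_le_left.trans h) (Sentence.inf_le_right.trans h')

theorem Sentence.sup_mono {a b c d : Sentence σ} (h : a ≤ b) (h' : c ≤ d) : a ⊔ c ≤ b ⊔ d :=
  Sentence.sup_le (h.trans Sentence.le_sup_left) (h'.trans Sentence.le_sup_right)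

theorem Sentence.himp_mono {a b c d : Sentence σ} (h : b ≤ a) (h' : c ≤ d) : a ⇨ c ≤ b ⇨ d :=
  Sentence.le_himp_iff.2 ((Sentence.inf_mono le_rfl h).trans
    ((Sentence.le_himp_iff.1 le_rfl).trans h'))

instance : HeytingAlgebra (LT σ) where
  sup := Quotient.map₂ (· ⊔ ·) fun _ _ h _ _ h' =>
    ⟨Sentence.sup_mono h.1 h'.1, Sentence.sup_mono h.2 h'.2⟩
  inf := Quotient.map₂ (· ⊓ ·) fun _ _ h _ _ h' =>
    ⟨Sentence.inf_mono h.1 h'.1, Sentence.inf_mono h.2 h'.2⟩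
  himp := Quotient.map₂ (· ⇨ ·) fun _ _ h _ _ h' =>
    ⟨Sentence.himp_mono h.2 h'.1, Sentence.himp_mono h.1 h'.2⟩
  bot := cls .bot isSentence_bot
  top := cls .top isSentence_top
  compl x := Quotient.map₂ (sa := AntisymmRel.setoid _ _) (sb := AntisymmRel.setoid _ _)
    (sc := AntisymmRel.setoid _ _) (fun φ ψ : Sentence σ => φ ⇨ ψ) (fun _ _ h _ _ h' =>
    ⟨Sentence.himp_mono h.2 h'.1, Sentence.himp_mono h.1 h'.2⟩) x (cls .bot isSentence_bot)
  le_sup_left a b := Quotient.inductionOn₂ a b fun _ _ => Sentence.le_sup_left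
  le_sup_right a b := Quotient.inductionOn₂ a b fun _ _ => Sentence.le_sup_right
  sup_le a b c := Quotient.inductionOn₃ a b c fun _ _ _ => Sentence.sup_le
  inf_le_left a b := Quotient.inductionOn₂ a b fun _ _ => Sentence.inf_le_left
  inf_le_right a b := Quotient.inductionOn₂ a b fun _ _ => Sentence.inf_le_right
  le_inf a b c := Quotient.inductionOn₃ a b c fun _ _ _ => Sentence.le_inf
  le_top a := Quotient.inductionOn a fun _ => Sentence.le_top
  bot_le a := Quotient.inductionOn a fun _ => Sentence.bot_le
  le_himp_iff a b c := Quotient.inductionOn₃ a b c fun _ _ _ => Sentence.le_himp_iff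
  himp_bot _ := rfl

/-! ### Modal operators on the Lindenbaum algebra. -/

/-- The box on the Lindenbaum algebra. -/
def lbox : LT σ → LT σ :=
  Quotient.map (fun φ : Sentence σ => (⟨.box φ.1, φ.2⟩ : Sentence σ))
    fun _ _ h => ⟨Thm.reg_box h.1, Thm.reg_box h.2⟩

/-- The diamond on the Lindenbaum algebra. -/
def ldia : LT σ → LT σ :=
  Quotient.map (fun φ : Sentence σ => (⟨.dia φ.1, φ.2⟩ : Sentence σ))
    fun _ _ h => ⟨Thm.reg_dia h.1, Thm.reg_dia h.2⟩

theorem lbox_mono {x y : LT σ} : x ≤ y → lbox x ≤ lbox y :=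
  Quotient.inductionOn₂ x y fun _ _ h => Thm.reg_box h

theorem ldia_mono {x y : LT σ} : x ≤ y → ldia x ≤ ldia y :=
  Quotient.inductionOn₂ x y fun _ _ h => Thm.reg_dia h

theorem Sentence.le_of_iff {φ ψ : Sentence σ} (h : Thm (axiomsT σ) (.iff φ.1 ψ.1)) :
    φ ≤ ψ ∧ ψ ≤ φ :=
  ⟨.mp (inf_le_left (φ := φ ⇨ ψ) (ψ := ψ ⇨ φ)) h,
    .mp (inf_le_right (φ := φ ⇨ ψ) (ψ := ψ ⇨ φ)) h⟩

theorem lbox_inf (x y : LT σ) : lbox (x ⊓ y) = lbox x ⊓ lbox y :=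
  le_antisymm (le_inf (lbox_mono inf_le_left) (lbox_mono inf_le_right))
    (Quotient.inductionOn₂ x y fun φ ψ => (Sentence.le_of_iff
      (φ := ⟨_, isSentence_box.2 (isSentence_and.2 ⟨φ.2, ψ.2⟩)⟩)
      (ψ := ⟨_, isSentence_and.2 ⟨isSentence_box.2 φ.2, isSentence_box.2 ψ.2⟩⟩)
      (Thm.box_and φ.2 ψ.2)).2)

theorem lbox_top : lbox (⊤ : LT σ) = ⊤ :=
  top_unique (Sentence.le_of_thm (φ := ⟨.box .top, isSentence_top⟩) (ψ := ⊤) Thm.box_top)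

theorem ldia_sup_le (x y : LT σ) : ldia (x ⊔ y) ≤ ldia x ⊔ ldia y :=
  Quotient.inductionOn₂ x y fun φ ψ => (Sentence.le_of_iff
    (φ := ⟨_, isSentence_dia.2 (isSentence_or.2 ⟨φ.2, ψ.2⟩)⟩)
    (ψ := ⟨_, isSentence_or.2 ⟨isSentence_dia.2 φ.2, isSentence_dia.2 ψ.2⟩⟩)
    (Thm.dia_or φ.2 ψ.2)).1

theorem ldia_bot : ldia (⊥ : LT σ) = ⊥ :=
  bot_unique (Thm.dia_bot : Thm (axiomsT σ) (.imp (.dia .bot) .bot))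

theorem ldia_himp_lbox_le (x y : LT σ) : ldia x ⇨ lbox y ≤ lbox (x ⇨ y) :=
  Quotient.inductionOn₂ x y fun φ ψ => Thm.fs1 φ.2 ψ.2

theorem ldia_himp_le (x y : LT σ) : ldia (x ⇨ y) ≤ lbox x ⇨ ldia y :=
  Quotient.inductionOn₂ x y fun φ ψ => Thm.fs2 φ.2 ψ.2

theorem lbox_le (x : LT σ) : lbox x ≤ x :=
  Quotient.inductionOn x fun φ => Thm.ax ⟨φ.1, φ.2, Or.inl rfl⟩

theorem le_ldia (x : LT σ) : x ≤ ldia x :=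
  Quotient.inductionOn x fun φ => Thm.ax ⟨φ.1, φ.2, Or.inr rfl⟩

theorem ldia_top : ldia (⊤ : LT σ) = ⊤ := top_unique (le_ldia ⊤)

/-- Residuate `x` to the right, apply the monotone `ldia`, and use the axiom `◇(φ → ψ) → (□φ → ◇ψ)`.
-/
theorem lbox_inf_ldia_le {x y z : LT σ} (h : x ⊓ y ≤ z) : lbox x ⊓ ldia y ≤ ldia z := by
  have h1 : y ≤ x ⇨ z := by rw [le_himp_iff, inf_comm]; exact h
  have h2 := (ldia_mono h1).trans (ldia_himp_le x z)
  rwa [le_himp_iff, inf_comm] at h2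

theorem cls_congr {φ ψ : Formula σ} (e : φ = ψ) (h : IsSentence φ) :
    cls φ h = cls ψ (e ▸ h) := by subst e; rfl

/-! ### Supports, quantifier rules and interpolation. -/

/-- The classes of the sentences all of whose constants lie in `K`. -/
def supp (K : Set σ.Const) : Set (LT σ) := {x | ∃ φ h, consts φ ⊆ K ∧ cls φ h = x}

variable {K J : Set σ.Const} {x y : LT σ}

theorem supp_mono (h : K ⊆ J) : supp K ⊆ supp J := by
  rintro x ⟨φ, hφ, hK, rfl⟩; exact ⟨φ, hφ, hK.trans h, rfl⟩

theorem cls_mem_supp {φ : Formula σ} {h : IsSentence φ} (hK : consts φ ⊆ K) : cls φ h ∈ supp K :=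
  ⟨φ, h, hK, rfl⟩

theorem bot_mem_supp : ⊥ ∈ supp K := ⟨.bot, isSentence_bot, fun _ h => h.elim, rfl⟩

theorem top_mem_supp : ⊤ ∈ supp K := ⟨.top, isSentence_top, fun _ h => (or_self_iff.1 h).elim, rfl⟩

theorem inf_mem_supp (hx : x ∈ supp K) (hy : y ∈ supp K) : x ⊓ y ∈ supp K := by
  obtain ⟨φ, hφ, h1, rfl⟩ := hx
  obtain ⟨ψ, hψ, h2, rfl⟩ := hy
  exact ⟨.and φ ψ, isSentence_and.2 ⟨hφ, hψ⟩, Set.union_subset h1 h2, rfl⟩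

theorem sup_mem_supp (hx : x ∈ supp K) (hy : y ∈ supp K) : x ⊔ y ∈ supp K := by
  obtain ⟨φ, hφ, h1, rfl⟩ := hx
  obtain ⟨ψ, hψ, h2, rfl⟩ := hy
  exact ⟨.or φ ψ, isSentence_or.2 ⟨hφ, hψ⟩, Set.union_subset h1 h2, rfl⟩

theorem himp_mem_supp (hx : x ∈ supp K) (hy : y ∈ supp K) : x ⇨ y ∈ supp K := by
  obtain ⟨φ, hφ, h1, rfl⟩ := hx
  obtain ⟨ψ, hψ, h2, rfl⟩ := hy
  exact ⟨.imp φ ψ, isSentence_imp.2 ⟨hφ, hψ⟩, Set.union_subset h1 h2, rfl⟩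

theorem lbox_mem_supp (hx : x ∈ supp K) : lbox x ∈ supp K := by
  obtain ⟨φ, hφ, h1, rfl⟩ := hx
  exact ⟨.box φ, hφ, h1, rfl⟩

theorem ldia_mem_supp (hx : x ∈ supp K) : ldia x ∈ supp K := by
  obtain ⟨φ, hφ, h1, rfl⟩ := hx
  exact ⟨.dia φ, hφ, h1, rfl⟩

theorem exists_finite_supp (hx : x ∈ supp K) : ∃ J : Set σ.Const, J.Finite ∧ J ⊆ K ∧ x ∈ supp J := by
  obtain ⟨φ, hφ, h1, rfl⟩ := hx
  exact ⟨consts φ, finite_consts φ, h1, cls_mem_supp subset_rfl⟩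

theorem cls_all_le {v : ℕ} {φ : Formula σ} (h : FreeOnly v φ) (c : σ.Const) :
    cls (.all v φ) (isSentence_all.2 h) ≤ cls (φ.inst v c) (h.inst c) :=
  cls_le.2 (.univ v c h)

theorem le_cls_ex {v : ℕ} {φ : Formula σ} (h : FreeOnly v φ) (c : σ.Const) :
    cls (φ.inst v c) (h.inst c) ≤ cls (.ex v φ) (isSentence_ex.2 h) :=
  cls_le.2 (.exist v c h)

/-- The generalisation rule applied to the constant `c`: as `c` occurs neither in `φ` nor in a
representative of `x`, replacing it by `v` turns the instance back into `φ` and leaves `x` alone. -/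
theorem le_cls_all {v : ℕ} {φ : Formula σ} (h : FreeOnly v φ) {c : σ.Const}
    (hc : ¬ HasConst c φ) (hx : x ∈ supp {c}ᶜ) (hle : x ≤ cls (φ.inst v c) (h.inst c)) :
    x ≤ cls (.all v φ) (isSentence_all.2 h) := by
  obtain ⟨ψ, hψ, hψc, rfl⟩ := hx
  have hψc : ¬ HasConst c ψ := fun h => hψc h rfl
  have := Thm.gen v c (cls_le.1 hle)
    ⟨substitutable_of_not_hasConst hψc v, substitutable_inst hc v⟩
  simp only [Formula.replaceConst, replaceConst_inst hc, replaceConst_of_not_hasConst hψc] at this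
  exact cls_le.2 (.mp (.all_con v hψ h) this)

theorem cls_ex_le {v : ℕ} {φ : Formula σ} (h : FreeOnly v φ) {c : σ.Const}
    (hc : ¬ HasConst c φ) (hx : x ∈ supp {c}ᶜ) (hle : cls (φ.inst v c) (h.inst c) ≤ x) :
    cls (.ex v φ) (isSentence_ex.2 h) ≤ x := by
  obtain ⟨ψ, hψ, hψc, rfl⟩ := hx
  have hψc : ¬ HasConst c ψ := fun h => hψc h rfl
  have := Thm.gen v c (cls_le.1 hle)
    ⟨substitutable_inst hc v, substitutable_of_not_hasConst hψc v⟩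
  simp only [Formula.replaceConst, replaceConst_inst hc, replaceConst_of_not_hasConst hψc] at this
  exact cls_le.2 (.mp (.all_ant v h hψ) this)

/-- The interpolant is `∃v φ[c := v]`: it follows from `φ` by instantiation at `c`, and it implies
`x` because `x` has a representative without `c`. -/
theorem exists_interpolant_compl {c : σ.Const} {φ : Formula σ} (hφ : IsSentence φ)
    (hx : x ∈ supp {c}ᶜ) (hle : cls φ hφ ≤ x) :
    ∃ ψ hψ, consts ψ ⊆ consts φ \ {c} ∧ cls φ hφ ≤ cls ψ hψ ∧ cls ψ hψ ≤ x := by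
  obtain ⟨v, hv⟩ := exists_substitutable c φ
  have hs : (φ.replaceConst c v).inst v c = φ :=
    inst_replaceConst (by rw [show fv φ = ∅ from hφ]; exact Set.notMem_empty v) (hv v le_rfl)
  have hf := hφ.replaceConst c v
  have he : cls _ (hf.inst c) = cls φ hφ := cls_congr hs _
  refine ⟨.ex v (φ.replaceConst c v), isSentence_ex.2 hf, fun d hd => ?_, ?_, ?_⟩
  · obtain ⟨h1, h2⟩ := hasConst_replaceConst (φ := φ) hd
    exact ⟨h2, h1⟩
  · exact he.symm.le.trans (le_cls_ex hf c)
  · exact cls_ex_le hf (fun h => (hasConst_replaceConst h).1 rfl) hx (he.le.trans hle)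

/-- Interpolation with respect to constants. -/
theorem exists_interpolant {x y : LT σ} (hx : x ∈ supp K) (hy : y ∈ supp J) (hle : x ≤ y) :
    ∃ z ∈ supp (K ∩ J), x ≤ z ∧ z ≤ y := by
  obtain ⟨φ, hφ, hK, rfl⟩ := hx
  -- Induction on the number of constants of `φ` outside `J`; each round quantifies one of them
  -- away.
  obtain ⟨n, hn⟩ : ∃ n, (consts φ \ J).ncard = n := ⟨_, rfl⟩
  induction n using Nat.strong_induction_on generalizing φ with
  | _ n ih =>
    rcases (consts φ \ J).eq_empty_or_nonempty with he | ⟨c, hc⟩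
    · exact ⟨_, cls_mem_supp (Set.subset_inter hK (Set.sdiff_eq_empty.1 he)), le_rfl, hle⟩
    have hy' : y ∈ supp {c}ᶜ :=
      supp_mono (Set.subset_compl_singleton_iff.2 hc.2) hy
    obtain ⟨ψ, hψ, h1, h2, h3⟩ := exists_interpolant_compl hφ hy' hle
    have h4 : consts ψ \ J ⊂ consts φ \ J := by
      refine ⟨fun d hd => ⟨(h1 hd.1).1, hd.2⟩, fun h => (h1 (h hc).1).2 rfl⟩
    obtain ⟨z, hz, hz1, hz2⟩ := ih _ (hn ▸ Set.ncard_lt_ncard h4 (finite_consts φ).sdiff) ψ hψ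
      ((h1.trans Set.sdiff_subset).trans hK) h3 rfl
    exact ⟨z, hz, h2.trans hz1, hz2⟩

end Lindenbaum

/-! ## Derivability over a tree of labels

The nodes of the tree are lists, the children of `a` being the lists `i :: a`. Each constant is
introduced at one node, its owner, and is available at the nodes above its owner. -/

section Derivability

variable {ι : Type*} {o : σ.Const → List ι}

/-- The part of the Lindenbaum algebra available at the node `a`. -/
def Lang (o : σ.Const → List ι) (a : List ι) : Set (LT σ) := supp {c | o c <:+ a}

theorem lang_cons {i : ι} {a : List ι} : Lang o a ⊆ Lang o (i :: a) :=
  supp_mono fun _ h => h.trans (List.suffix_cons i a)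

/-- Derivability from a set of labelled assumptions. -/
inductive Der (o : σ.Const → List ι) (S : Set (List ι × LT σ)) : List ι → LT σ → Prop
  | hyp {a : List ι} {x : LT σ} : (a, x) ∈ S → x ∈ Lang o a → Der o S a x
  | le {a : List ι} {x y : LT σ} : Der o S a x → x ≤ y → y ∈ Lang o a → Der o S a y
  | top {a : List ι} : Der o S a ⊤
  | inf {a : List ι} {x y : LT σ} : Der o S a x → Der o S a y → Der o S a (x ⊓ y)
  -- The language conditions in the modal rules are not automatic. A representative of `lbox x` at
  -- `a` need not come from one of `x`, and an element at a child may involve constants that are not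
  -- available at the parent.
  | box {a : List ι} {i : ι} {x : LT σ} : Der o S a (lbox x) → x ∈ Lang o a → Der o S (i :: a) x
  | dia {a : List ι} {i : ι} {x : LT σ} : Der o S (i :: a) x → x ∈ Lang o a → Der o S a (ldia x)

variable {S S' : Set (List ι × LT σ)} {a b e p : List ι} {i : ι} {x y z : LT σ}

theorem Der.mem_lang (h : Der o S a x) : x ∈ Lang o a := by
  induction h with
  | hyp _ h | le _ _ h _ => exact h
  | top => exact top_mem_supp
  | inf _ _ ih1 ih2 => exact inf_mem_supp ih1 ih2
  | box _ h _ => exact lang_cons h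
  | dia _ h _ => exact ldia_mem_supp h

theorem Der.cut (h : Der o S a x) (hS : ∀ b y, (b, y) ∈ S → y ∈ Lang o b → Der o S' b y) :
    Der o S' a x := by
  induction h with
  | hyp h h' => exact hS _ _ h h'
  | le _ h h' ih => exact ih.le h h'
  | top => exact .top
  | inf _ _ ih1 ih2 => exact ih1.inf ih2
  | box _ h ih => exact ih.box h
  | dia _ h ih => exact ih.dia h

theorem Der.mono (h : Der o S a x) (hS : S ⊆ S') : Der o S' a x :=
  h.cut fun _ _ h h' => .hyp (hS h) h'

theorem Der.cut_insert (h : Der o (insert (b, y) S) a x) (hy : Der o S b y) : Der o S a x :=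
  h.cut fun c z hz hz' => by
    rcases hz with hz | hz
    · cases hz; exact hy
    · exact .hyp hz hz'

theorem Der.cut_insert_insert (h : Der o (insert (b, y) S) a x)
    (hy : y ∈ Lang o b → Der o (insert (e, z) S) b y) : Der o (insert (e, z) S) a x :=
  h.cut fun c z hz hz' => by
    rcases hz with hz | hz
    · cases hz; exact hy hz'
    · exact .hyp (Or.inr hz) hz'

/-- Inconsistency spreads over the tree: down to the root by `◇⊥ = ⊥`, and from there up by `⊥ ≤
□⊥`. -/
theorem Der.bot (h : Der o S a ⊥) (b : List ι) : Der o S b ⊥ := by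
  have up : ∀ a, Der o S a ⊥ → Der o S [] ⊥ := by
    intro a
    induction a with
    | nil => exact id
    | cons i a ih => exact fun h => ih ((h.dia bot_mem_supp).le ldia_bot.le bot_mem_supp)
  induction b with
  | nil => exact up a h
  | cons i b ih => exact (ih.le bot_le (lbox_mem_supp bot_mem_supp)).box bot_mem_supp

theorem Der.exists_of_iUnion {T : ℕ → Set (List ι × LT σ)} (hT : Monotone T)
    (h : Der o (⋃ n, T n) a x) : ∃ n, Der o (T n) a x := by
  induction h with
  | hyp h h' => obtain ⟨n, hn⟩ := Set.mem_iUnion.1 h; exact ⟨n, .hyp hn h'⟩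
  | le _ h h' ih => exact ih.imp fun n hn => hn.le h h'
  | top => exact ⟨0, .top⟩
  | inf _ _ ih1 ih2 =>
    obtain ⟨n, hn⟩ := ih1
    obtain ⟨m, hm⟩ := ih2
    exact ⟨max n m, (hn.mono (hT (le_max_left n m))).inf (hm.mono (hT (le_max_right n m)))⟩
  | box _ h ih => exact ih.imp fun n hn => hn.box h
  | dia _ h ih => exact ih.imp fun n hn => hn.dia h

/-! ### Towers: derivability in the cone above a node. -/

/-- The elements forced at the nodes above `e`, when those in `B` are forced at `e` and those
in `K b` are known at the node `b`. -/
def Tower (o : σ.Const → List ι) (e : List ι) (B : Set (LT σ)) (K : List ι → Set (LT σ)) :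
    List ι → Set (LT σ)
  | [] => B
  -- Normal form of a derivation at a child: one local fact `s` and one boxed fact `m` inherited
  -- from the parent suffice, since both kinds are closed under meets.
  | i :: l => {x | ∃ s ∈ K (i :: (l ++ e)), ∃ m ∈ Lang o (l ++ e), lbox m ∈ Tower o e B K l ∧ s ⊓ m ≤ x}

/-- The conditions under which a tower is closed under derivability. -/
structure TowerBase (o : σ.Const → List ι) (e : List ι) (B : Set (LT σ))
    (K : List ι → Set (LT σ)) : Prop where
  le : ∀ x ∈ B, ∀ y, x ≤ y → y ∈ B
  inf : ∀ x ∈ B, ∀ y ∈ B, x ⊓ y ∈ B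
  sub : K e ⊆ B
  top_known : ∀ b, ⊤ ∈ K b
  inf_known : ∀ b, ∀ x ∈ K b, ∀ y ∈ K b, x ⊓ y ∈ K b
  -- The one condition linking levels. The known element `x` may lie outside the parent's language,
  -- so its effect there is tested on the expressible `y` above it; allowing `z` below `y` leaves
  -- room for an interpolant.
  dia_known : ∀ b i, ∀ x ∈ K (i :: b), ∀ y ∈ Lang o b, x ≤ y → ∃ z ≤ y, ldia z ∈ K b

namespace TowerBase

variable {B : Set (LT σ)} {K : List ι → Set (LT σ)} {l : List ι}

theorem tower_le (H : TowerBase o e B K) (hx : x ∈ Tower o e B K l) (h : x ≤ y) :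
    y ∈ Tower o e B K l := by
  cases l with
  | nil => exact H.le _ hx _ h
  | cons i l =>
    obtain ⟨s, hs, m, hm, h1, h2⟩ := hx
    exact ⟨s, hs, m, hm, h1, h2.trans h⟩

theorem tower_inf (H : TowerBase o e B K) (hx : x ∈ Tower o e B K l) (hy : y ∈ Tower o e B K l) :
    x ⊓ y ∈ Tower o e B K l := by
  induction l generalizing x y with
  | nil => exact H.inf _ hx _ hy
  | cons i l ih =>
    obtain ⟨s, hs, m, hm, h1, h2⟩ := hx
    obtain ⟨s', hs', m', hm', h1', h2'⟩ := hy
    refine ⟨s ⊓ s', H.inf_known _ _ hs _ hs', m ⊓ m', inf_mem_supp hm hm', ?_, ?_⟩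
    · rw [lbox_inf]; exact ih h1 h1'
    · rw [inf_inf_inf_comm]; exact inf_le_inf h2 h2'

theorem top_mem_tower (H : TowerBase o e B K) : ⊤ ∈ Tower o e B K l := by
  induction l with
  | nil => exact H.sub (H.top_known e)
  | cons i l ih => exact ⟨⊤, H.top_known _, ⊤, top_mem_supp, lbox_top.symm ▸ ih, le_top⟩

theorem known_sub_tower (H : TowerBase o e B K) : K (l ++ e) ⊆ Tower o e B K l := by
  cases l with
  | nil => exact H.sub
  | cons i l =>
    exact fun x hx => ⟨x, hx, ⊤, top_mem_supp, (lbox_top (σ := σ)).symm ▸ H.top_mem_tower, inf_le_left⟩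

theorem tower_box (H : TowerBase o e B K) (hx : lbox x ∈ Tower o e B K l)
    (hx' : x ∈ Lang o (l ++ e)) : x ∈ Tower o e B K (i :: l) :=
  ⟨⊤, H.top_known _, x, hx', hx, inf_le_right⟩

/-- From `s ⊓ m ≤ x` one gets `s ≤ m ⇨ x`, which is expressible at the parent. So the parent knows
`◇` of something below `m ⇨ x`, and together with `□m` this gives `◇x`. -/
theorem tower_dia (H : TowerBase o e B K) (hx : x ∈ Tower o e B K (i :: l))
    (hx' : x ∈ Lang o (l ++ e)) : ldia x ∈ Tower o e B K l := by
  obtain ⟨s, hs, m, hm, h1, h2⟩ := hx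
  obtain ⟨z, hz, hzK⟩ := H.dia_known _ _ s hs (m ⇨ x) (himp_mem_supp hm hx') (le_himp_iff.2 h2)
  refine H.tower_le (H.tower_inf h1 (H.known_sub_tower hzK)) (lbox_inf_ldia_le ?_)
  rw [inf_comm]; exact le_himp_iff.1 hz

/-- Induction on derivations, with towers over the node `e` and a predicate `Q` elsewhere. -/
theorem der_induction (H : TowerBase o e B K) {Q : List ι → LT σ → Prop}
    (hyp_mem : ∀ x, (e, x) ∈ S → x ∈ Lang o e → x ∈ B)
    (hyp_above : ∀ i l x, (i :: (l ++ e), x) ∈ S → x ∈ Lang o (i :: (l ++ e)) →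
      x ∈ K (i :: (l ++ e)))
    (hyp_not : ∀ b x, ¬ e <:+ b → (b, x) ∈ S → x ∈ Lang o b → Q b x)
    (le : ∀ b x y, ¬ e <:+ b → Q b x → x ≤ y → y ∈ Lang o b → Q b y)
    (top : ∀ b, ¬ e <:+ b → Q b ⊤)
    (inf : ∀ b x y, ¬ e <:+ b → Q b x → Q b y → Q b (x ⊓ y))
    (box : ∀ b i x, ¬ e <:+ i :: b → Q b (lbox x) → x ∈ Lang o b → Q (i :: b) x)
    (dia : ∀ b i x, ¬ e <:+ i :: b → Q (i :: b) x → x ∈ Lang o b → Q b (ldia x))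
    (box_in : ∀ p i x, e = i :: p → Q p (lbox x) → x ∈ Lang o p → x ∈ B)
    (dia_out : ∀ p i x, e = i :: p → x ∈ B → x ∈ Lang o p → Q p (ldia x))
    (h : Der o S b y) : (∀ l, b = l ++ e → y ∈ Tower o e B K l) ∧ (¬ e <:+ b → Q b y) := by
  induction h with
  | @hyp b y h h' =>
    refine ⟨?_, fun hb => hyp_not b y hb h h'⟩
    rintro (_ | ⟨i, l⟩) rfl
    · exact hyp_mem y h h'
    · exact H.known_sub_tower (hyp_above i l y h h')
  | @le b x y _ hxy hy ih =>
    exact ⟨fun l hl => H.tower_le (ih.1 l hl) hxy, fun hb => le _ _ _ hb (ih.2 hb) hxy hy⟩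
  | top => exact ⟨fun l _ => H.top_mem_tower, top _⟩
  | @inf b x y _ _ ih1 ih2 =>
    exact ⟨fun l hl => H.tower_inf (ih1.1 l hl) (ih2.1 l hl),
      fun hb => inf _ _ _ hb (ih1.2 hb) (ih2.2 hb)⟩
  | @box b i x _ hx ih =>
    constructor
    · rintro (_ | ⟨j, l⟩) hl
      · refine box_in b i x hl.symm (ih.2 fun hb => ?_) hx
        have := hb.length_le
        simp [← show i :: b = e from hl] at this
      · obtain ⟨rfl, rfl⟩ := List.cons.inj hl
        exact H.tower_box (ih.1 l rfl) hx
    · intro hb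
      exact box b i x hb (ih.2 fun hb' => hb (hb'.trans (List.suffix_cons i b))) hx
  | @dia b i x _ hx ih =>
    constructor
    · rintro l rfl
      exact H.tower_dia (ih.1 (i :: l) rfl) hx
    · intro hb
      by_cases he : e = i :: b
      · exact dia_out b i x he (ih.1 [] he.symm) hx
      · have hb' : ¬ e <:+ i :: b := fun h => (List.suffix_cons_iff.1 h).elim he hb
        exact dia b i x hb' (ih.2 hb') hx

end TowerBase

/-! ### Deduction -/

/-- The elements following at the node `a` from `x`. -/
def DedBase (o : σ.Const → List ι) (S : Set (List ι × LT σ)) (a : List ι) (x : LT σ) :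
    Set (LT σ) := {y | ∃ z, Der o S a z ∧ z ⊓ x ≤ y}

theorem dedBase_towerBase : TowerBase o a (DedBase o S a x) (fun b => {y | Der o S b y}) where
  le := by rintro y ⟨z, hz, h⟩ w hw; exact ⟨z, hz, h.trans hw⟩
  inf := by
    rintro y ⟨z, hz, h⟩ y' ⟨z', hz', h'⟩
    exact ⟨z ⊓ z', hz.inf hz', le_inf ((inf_le_inf_right x inf_le_left).trans h)
      ((inf_le_inf_right x inf_le_right).trans h')⟩
  sub := fun y hy => ⟨y, hy, inf_le_left⟩
  top_known := fun _ => .top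
  inf_known := fun _ _ h _ h' => Der.inf h h'
  dia_known := fun _ _ _ hx y hy h => ⟨y, le_rfl, (Der.le hx h (lang_cons hy)).dia hy⟩

/-- In the cone above `a`, the new assumption contributes only to the base of the tower. Outside, it
acts through a single `◇t` at the parent, with `t` a consequence of `x` at `a`. The deduction
theorem at the parent is taken as hypothesis, in order to handle information that leaves the cone
and returns. -/
theorem Der.insert_aux
    (ih : ∀ i p, a = i :: p → ∀ x y, Der o (insert (p, x) S) p y → Der o S p (x ⇨ y) ∨ x ∉ Lang o p)
    (h : Der o (insert (a, x) S) b y) :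
    (∀ l, b = l ++ a → y ∈ Tower o a (DedBase o S a x) (fun b => {y | Der o S b y}) l) ∧
    (¬ a <:+ b → ∀ i p, a = i :: p → ∃ t ∈ Lang o p, t ∈ DedBase o S a x ∧
      Der o (insert (p, ldia t) S) b y) := by
  refine dedBase_towerBase.der_induction
    (Q := fun b y => ∀ i p, a = i :: p → ∃ t ∈ Lang o p, t ∈ DedBase o S a x ∧
      Der o (insert (p, ldia t) S) b y) ?_ ?_ ?_ ?_ ?_ ?_ ?_ ?_ ?_ ?_ h
  · rintro y (hy | hy) hy'
    · cases hy; exact ⟨⊤, .top, inf_le_right⟩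
    · exact ⟨y, .hyp hy hy', inf_le_left⟩
  · rintro i l y (hy | hy) hy'
    · have := congrArg (fun z => z.1.length) hy
      simp at this; omega
    · exact .hyp hy hy'
  · rintro b y hb (hy | hy) hy'
    · cases hy; exact (hb List.suffix_rfl).elim
    · exact fun i p _ => ⟨⊤, top_mem_supp, ⟨⊤, .top, le_top⟩, .hyp (Or.inr hy) hy'⟩
  · intro b x y _ h hxy hy i p hp
    obtain ⟨t, ht, h1, h2⟩ := h i p hp
    exact ⟨t, ht, h1, h2.le hxy hy⟩
  · exact fun b _ i p _ => ⟨⊤, top_mem_supp, ⟨⊤, .top, le_top⟩, .top⟩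
  -- Two diamonds at the parent are merged into one, since `◇(t ⊓ t')` implies both.
  · intro b y y' _ h h' i p hp
    obtain ⟨t, ht, h1, h2⟩ := h i p hp
    obtain ⟨t', ht', h1', h2'⟩ := h' i p hp
    have key : ∀ s, t ⊓ t' ≤ s → s ∈ Lang o p → Der o (insert (p, ldia (t ⊓ t')) S) p (ldia s) :=
      fun s hs hs' => (Der.hyp (Or.inl rfl) (ldia_mem_supp (inf_mem_supp ht ht'))).le (ldia_mono hs)
        (ldia_mem_supp hs')
    exact ⟨t ⊓ t', inf_mem_supp ht ht', dedBase_towerBase.inf _ h1 _ h1',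
      (h2.cut_insert_insert fun _ => key _ inf_le_left ht).inf
        (h2'.cut_insert_insert fun _ => key _ inf_le_right ht')⟩
  · intro b j y _ h hy i p hp
    obtain ⟨t, ht, h1, h2⟩ := h i p hp
    exact ⟨t, ht, h1, h2.box hy⟩
  · intro b j y _ h hy i p hp
    obtain ⟨t, ht, h1, h2⟩ := h i p hp
    exact ⟨t, ht, h1, h2.dia hy⟩
  -- Re-entry into the cone: deduction at the parent gives `◇t ⇨ □y`, hence `□(t ⇨ y)` by the first
  -- Fischer Servi axiom. So `t ⇨ y` is available at `a` without `x`, and `x` gives `t` there.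
  · intro p i y hp h hy
    obtain ⟨t, ht, ⟨z, hz, hzt⟩, h2⟩ := h i p hp
    have h3 := (ih i p hp _ _ h2).resolve_right (not_not_intro (ldia_mem_supp ht))
    have h4 := (h3.le (ldia_himp_lbox_le t y) (lbox_mem_supp (himp_mem_supp ht hy))).box (i := i)
      (himp_mem_supp ht hy)
    rw [← hp] at h4
    refine ⟨_, hz.inf h4, ?_⟩
    rw [inf_right_comm]
    exact (inf_le_inf_right _ hzt).trans inf_himp_le
  · intro p i y hp h hy j q hq
    obtain ⟨rfl, rfl⟩ := List.cons.inj (hp.symm.trans hq)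
    exact ⟨y, hy, h, .hyp (Or.inl rfl) (ldia_mem_supp hy)⟩

/-- The deduction theorem at a node, by induction on its depth; the base of the tower at `a` already
is the claim, after residuation. -/
theorem Der.himp (hx : x ∈ Lang o a) (h : Der o (insert (a, x) S) a y) : Der o S a (x ⇨ y) := by
  induction a generalizing x y with
  | nil =>
    obtain ⟨z, hz, hzy⟩ := (Der.insert_aux (fun i p hp => by cases hp) h).1 [] rfl
    exact hz.le (le_himp_iff.2 hzy) (himp_mem_supp hx h.mem_lang)
  | cons i a ih =>
    obtain ⟨z, hz, hzy⟩ := (Der.insert_aux (fun j p hp x y hy => by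
      obtain ⟨rfl, rfl⟩ := List.cons.inj hp
      by_cases hx : x ∈ Lang o a
      · exact Or.inl (ih hx hy)
      · exact Or.inr hx) h).1 [] rfl
    exact hz.le (le_himp_iff.2 hzy) (himp_mem_supp hx h.mem_lang)

theorem Der.insert_cases (h : Der o (insert (a, x) S) b y) :
    (∀ l, b = l ++ a → y ∈ Tower o a (DedBase o S a x) (fun b => {y | Der o S b y}) l) ∧
    (¬ a <:+ b → ∀ i p, a = i :: p → ∃ t ∈ Lang o p, t ∈ DedBase o S a x ∧
      Der o (insert (p, ldia t) S) b y) :=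
  h.insert_aux fun _ p _ x _ h => by
    by_cases hx : x ∈ Lang o p
    · exact Or.inl (h.himp hx)
    · exact Or.inr hx

theorem sup_mem_of_dedBase {x' y' : LT σ} (hx : x ∈ Lang o a) (hx' : x' ∈ Lang o a)
    (h : y ∈ DedBase o S a x) (h' : y' ∈ DedBase o S a x') (hz : y ⊔ y' ≤ z) (hz' : z ∈ Lang o a) :
    Der o (insert (a, x ⊔ x') S) a z := by
  obtain ⟨w, hw, h1⟩ := h
  obtain ⟨w', hw', h1'⟩ := h'
  refine (((hw.inf hw').mono (Set.subset_insert _ _)).inf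
    (.hyp (Or.inl rfl) (sup_mem_supp hx hx'))).le ?_ hz'
  rw [inf_sup_left]
  exact sup_le ((inf_le_inf_right x inf_le_left).trans (h1.trans (le_sup_left.trans hz)))
    ((inf_le_inf_right x' inf_le_right).trans (h1'.trans (le_sup_right.trans hz)))

/-- The two towers are joined level by level: `□m` and `□m'` both imply `□(m ⊔ m')`, and
distributivity combines the local facts. -/
theorem sup_mem_of_tower {x' y' : LT σ} {l : List ι} (hx : x ∈ Lang o a) (hx' : x' ∈ Lang o a)
    (h : y ∈ Tower o a (DedBase o S a x) (fun b => {y | Der o S b y}) l)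
    (h' : y' ∈ Tower o a (DedBase o S a x') (fun b => {y | Der o S b y}) l)
    (hz : y ⊔ y' ≤ z) (hz' : z ∈ Lang o (l ++ a)) :
    Der o (insert (a, x ⊔ x') S) (l ++ a) z := by
  induction l generalizing y y' z with
  | nil => exact sup_mem_of_dedBase hx hx' h h' hz hz'
  | cons i l ih =>
    obtain ⟨s, hs, m, hm, h1, h2⟩ := h
    obtain ⟨s', hs', m', hm', h1', h2'⟩ := h'
    have h3 := (ih h1 h1' (sup_le (lbox_mono le_sup_left) (lbox_mono le_sup_right))
      (lbox_mem_supp (sup_mem_supp hm hm'))).box (i := i) (sup_mem_supp hm hm')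
    refine (((Der.inf hs hs').mono (Set.subset_insert _ _)).inf h3).le ?_ hz'
    rw [inf_sup_left]
    exact sup_le ((inf_le_inf_right m inf_le_left).trans (h2.trans (le_sup_left.trans hz)))
      ((inf_le_inf_right m' inf_le_right).trans (h2'.trans (le_sup_right.trans hz)))

/-- Proof by cases, which makes saturated sets prime. Inside the cone the towers are joined. Outside
it both assumptions act through diamonds at the parent, where induction applies because `◇`
distributes over joins. -/
theorem Der.sup {x' : LT σ} (hx : x ∈ Lang o a) (hx' : x' ∈ Lang o a)
    (h : Der o (insert (a, x) S) b y) (h' : Der o (insert (a, x') S) b y) :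
    Der o (insert (a, x ⊔ x') S) b y := by
  induction a generalizing x x' with
  | nil =>
    obtain ⟨l, rfl⟩ : [] <:+ b := List.nil_suffix
    exact sup_mem_of_tower hx hx' (h.insert_cases.1 l rfl) (h'.insert_cases.1 l rfl)
      (sup_le le_rfl le_rfl) h.mem_lang
  | cons i p ih =>
    by_cases hb : i :: p <:+ b
    · obtain ⟨l, rfl⟩ := hb
      exact sup_mem_of_tower hx hx' (h.insert_cases.1 l rfl) (h'.insert_cases.1 l rfl)
        (sup_le le_rfl le_rfl) h.mem_lang
    · obtain ⟨t, ht, h1, h2⟩ := h.insert_cases.2 hb i p rfl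
      obtain ⟨t', ht', h1', h2'⟩ := h'.insert_cases.2 hb i p rfl
      refine (ih (ldia_mem_supp ht) (ldia_mem_supp ht') h2 h2').cut_insert_insert fun hl => ?_
      exact ((sup_mem_of_dedBase hx hx' h1 h1' le_rfl (lang_cons (sup_mem_supp ht ht'))).dia
        (sup_mem_supp ht ht')).le (ldia_sup_le t t') hl

/-! ### Fresh nodes -/

/-- At a fresh child all that is known is `x` and what the parent boxes. Nothing but `⊤` is needed
as knowledge above, and its diamond is `⊤` by `φ → ◇φ`. -/
theorem freshNode_towerBase : TowerBase o (i :: p)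
    {y | ∃ m ∈ Lang o p, Der o (insert (p, ldia x) S) p (lbox m) ∧ m ⊓ x ≤ y} (fun _ => {⊤}) where
  le := by rintro y ⟨m, hm, h1, h2⟩ w hw; exact ⟨m, hm, h1, h2.trans hw⟩
  inf := by
    rintro y ⟨m, hm, h1, h2⟩ y' ⟨m', hm', h1', h2'⟩
    refine ⟨m ⊓ m', inf_mem_supp hm hm', lbox_inf m m' ▸ h1.inf h1',
      le_inf ((inf_le_inf_right x inf_le_left).trans h2)
      ((inf_le_inf_right x inf_le_right).trans h2')⟩
  sub := by rintro _ rfl; exact ⟨⊤, top_mem_supp, (lbox_top (σ := σ)).symm ▸ .top, le_top⟩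
  top_known := fun _ => rfl
  inf_known := by rintro _ _ rfl _ rfl; exact inf_idem _
  dia_known := by
    rintro _ _ _ rfl y _ h
    exact ⟨⊤, h, ldia_top⟩

/-- Any diamond that the fresh child sends to its parent already follows there from `◇x` and a boxed
`m`, by `lbox_inf_ldia_le`. -/
theorem Der.freshNode_cases (hS : ∀ b y, (b, y) ∈ S → ¬ i :: p <:+ b) (hx : x ∈ Lang o p)
    (h : Der o (insert (i :: p, x) S) b y) :
    (∀ l, b = l ++ i :: p → y ∈ Tower o (i :: p)
      {y | ∃ m ∈ Lang o p, Der o (insert (p, ldia x) S) p (lbox m) ∧ m ⊓ x ≤ y}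
      (fun _ => {⊤}) l) ∧
    (¬ i :: p <:+ b → Der o (insert (p, ldia x) S) b y) := by
  refine freshNode_towerBase.der_induction (Q := Der o (insert (p, ldia x) S))
    ?_ ?_ ?_ ?_ ?_ ?_ ?_ ?_ ?_ ?_ h
  · rintro y (hy | hy) hy'
    · cases hy; exact ⟨⊤, top_mem_supp, (lbox_top (σ := σ)).symm ▸ .top, inf_le_right⟩
    · exact (hS _ _ hy List.suffix_rfl).elim
  · rintro j l y (hy | hy) hy'
    · have := congrArg (fun z => z.1.length) hy
      simp at this; omega
    · exact (hS _ _ hy (List.suffix_append (j :: l) _)).elim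
  · rintro b y hb (hy | hy) hy'
    · cases hy; exact (hb List.suffix_rfl).elim
    · exact .hyp (Or.inr hy) hy'
  · exact fun b x y _ h => h.le
  · exact fun b _ => .top
  · exact fun b x y _ h => h.inf
  · exact fun b x y _ h => h.box
  · exact fun b x y _ h => h.dia
  · intro q j y hq h hy
    obtain ⟨rfl, rfl⟩ := List.cons.inj hq
    exact ⟨y, hy, h, inf_le_left⟩
  · rintro q j y hq ⟨m, hm, h1, h2⟩ hy
    obtain ⟨rfl, rfl⟩ := List.cons.inj hq
    exact (h1.inf (.hyp (Or.inl rfl) (ldia_mem_supp hx))).le (lbox_inf_ldia_le h2)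
      (ldia_mem_supp hy)

theorem Der.dia_elim (hS : ∀ b y, (b, y) ∈ S → ¬ i :: p <:+ b) (hx : x ∈ Lang o p)
    (hb : ¬ i :: p <:+ b) (h : Der o (insert (i :: p, x) S) b y) :
    Der o (insert (p, ldia x) S) b y :=
  (h.freshNode_cases hS hx).2 hb

/-- The case `x = ⊤` of a fresh child: the extra assumption `◇⊤` at the parent is provable by
reflexivity, so `y` must follow from some `m` that the parent boxes. -/
theorem Der.box_intro (hS : ∀ b y, (b, y) ∈ S → ¬ i :: p <:+ b) (hy : y ∈ Lang o p)
    (h : Der o S (i :: p) y) : Der o S p (lbox y) := by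
  obtain ⟨m, hm, h1, h2⟩ := ((h.mono (Set.subset_insert _ _)).freshNode_cases hS
    (top_mem_supp : ⊤ ∈ Lang o p)).1 [] rfl
  rw [inf_top_eq] at h2
  exact (h1.cut_insert ((ldia_top (σ := σ)).symm ▸ .top)).le (lbox_mono h2) (lbox_mem_supp hy)

/-! ### Fresh constants -/

variable {c : σ.Const}

theorem supp_compl_of_not_suffix (hx : x ∈ Lang o b) (h : ¬ o c <:+ b) : x ∈ supp {c}ᶜ :=
  supp_mono (Set.subset_compl_singleton_iff.2 h) hx

/-- Here `x` is the only assumption that may mention `c`. The known elements are the derivable ones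
without `c`; passing a diamond to the parent keeps them so because an interpolant is both free of
`c` and in the parent's language. -/
theorem freshConst_towerBase : TowerBase o a
    {y | ∃ z ∈ supp {c}ᶜ, Der o S a z ∧ z ⊓ x ≤ y} (fun b => {y | y ∈ supp {c}ᶜ ∧ Der o S b y}) where
  le := by rintro y ⟨z, hz, h1, h2⟩ w hw; exact ⟨z, hz, h1, h2.trans hw⟩
  inf := by
    rintro y ⟨m, hm, h1, h2⟩ y' ⟨m', hm', h1', h2'⟩
    exact ⟨m ⊓ m', inf_mem_supp hm hm', h1.inf h1',
      le_inf ((inf_le_inf_right x inf_le_left).trans h2)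
      ((inf_le_inf_right x inf_le_right).trans h2')⟩
  sub := fun y hy => ⟨y, hy.1, hy.2, inf_le_left⟩
  top_known := fun _ => ⟨top_mem_supp, .top⟩
  inf_known := fun _ _ h _ h' => ⟨inf_mem_supp h.1 h'.1, h.2.inf h'.2⟩
  dia_known := by
    rintro b i y ⟨hy, hy'⟩ z hz hyz
    obtain ⟨w, hw, h1, h2⟩ := exists_interpolant hy hz hyz
    have hwb : w ∈ Lang o b := supp_mono Set.inter_subset_right hw
    exact ⟨w, h2, ldia_mem_supp (supp_mono Set.inter_subset_left hw),
      (hy'.le h1 (lang_cons hwb)).dia hwb⟩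

theorem Der.of_freshConst_base {x' : LT σ} (hx' : x' ∈ Lang o a) (hyc : y ∈ supp {c}ᶜ)
    (hxx' : ∀ z ∈ supp {c}ᶜ, x ≤ z → x' ≤ z)
    (h : ∃ z ∈ supp {c}ᶜ, Der o (insert (a, x') S) a z ∧ z ⊓ x ≤ y) (hy : y ∈ Lang o a) :
    Der o (insert (a, x') S) a y := by
  obtain ⟨z, hz, h1, h2⟩ := h
  refine (h1.inf (.hyp (Or.inl rfl) hx')).le ?_ hy
  rw [inf_comm, ← le_himp_iff]
  refine hxx' _ (himp_mem_supp hz hyc) ?_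
  rwa [le_himp_iff, inf_comm]

/-- The boxed fact `m` may mention `c`, but the conclusion does not. Interpolating between `m` and
`s ⇨ y` gives a boxed fact without `c`, to which induction on the level applies. -/
theorem Der.of_freshConst_tower {x' : LT σ} {l : List ι} (hx' : x' ∈ Lang o a)
    (hxx' : ∀ z ∈ supp {c}ᶜ, x ≤ z → x' ≤ z) (hyc : y ∈ supp {c}ᶜ)
    (h : y ∈ Tower o a {y | ∃ z ∈ supp {c}ᶜ, Der o (insert (a, x') S) a z ∧ z ⊓ x ≤ y}
      (fun b => {y | y ∈ supp {c}ᶜ ∧ Der o (insert (a, x') S) b y}) l)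
    (hy : y ∈ Lang o (l ++ a)) : Der o (insert (a, x') S) (l ++ a) y := by
  induction l generalizing y with
  | nil => exact Der.of_freshConst_base hx' hyc hxx' h hy
  | cons i l ih =>
    obtain ⟨s, hs, m, hm, h1, h2⟩ := h
    have h3 : m ≤ s ⇨ y := by rwa [le_himp_iff, inf_comm]
    obtain ⟨w, hw, hw1, hw2⟩ := exists_interpolant hm (himp_mem_supp hs.1 hyc) h3
    have hwl : w ∈ Lang o (l ++ a) := supp_mono Set.inter_subset_left hw
    have h4 := ih (lbox_mem_supp (supp_mono Set.inter_subset_right hw))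
      (freshConst_towerBase.tower_le h1 (lbox_mono hw1)) (lbox_mem_supp hwl)
    refine ((h4.box hwl).inf hs.2).le ?_ hy
    exact le_himp_iff.1 hw2

theorem Der.freshConst_cases {x' : LT σ} (hS : ∀ b y, (b, y) ∈ S → y ∈ supp {c}ᶜ) (hc : o c = a)
    (hx' : x' ∈ Lang o a) (hxx' : ∀ z ∈ supp {c}ᶜ, x ≤ z → x' ≤ z)
    (h : Der o (insert (a, x) S) b y) :
    (∀ l, b = l ++ a → y ∈ Tower o a
      {y | ∃ z ∈ supp {c}ᶜ, Der o (insert (a, x') S) a z ∧ z ⊓ x ≤ y}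
      (fun b => {y | y ∈ supp {c}ᶜ ∧ Der o (insert (a, x') S) b y}) l) ∧
    (¬ a <:+ b → Der o (insert (a, x') S) b y) := by
  refine freshConst_towerBase.der_induction (Q := Der o (insert (a, x') S))
    ?_ ?_ ?_ ?_ ?_ ?_ ?_ ?_ ?_ ?_ h
  · rintro y (hy | hy) hy'
    · cases hy; exact ⟨⊤, top_mem_supp, .top, inf_le_right⟩
    · exact ⟨y, hS _ _ hy, .hyp (Or.inr hy) hy', inf_le_left⟩
  · rintro j l y (hy | hy) hy'
    · have := congrArg (fun z => z.1.length) hy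
      simp at this; omega
    · exact ⟨hS _ _ hy, .hyp (Or.inr hy) hy'⟩
  · rintro b y hb (hy | hy) hy'
    · cases hy; exact (hb List.suffix_rfl).elim
    · exact .hyp (Or.inr hy) hy'
  · exact fun b x y _ h => h.le
  · exact fun b _ => .top
  · exact fun b x y _ h => h.inf
  · exact fun b x y _ h => h.box
  · exact fun b x y _ h => h.dia
  · rintro p i y rfl h hy
    -- The owner of `c` is longer than its parent, so nothing coming up from the parent can mention
    -- `c`.
    refine ⟨y, supp_compl_of_not_suffix hy fun h => ?_, h.box hy, inf_le_left⟩
    have := h.length_le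
    simp [hc] at this
  · rintro p i y rfl h hy
    refine (Der.of_freshConst_base hx' (supp_compl_of_not_suffix hy fun h => ?_) hxx' h
      (lang_cons hy)).dia hy
    have := h.length_le
    simp [hc] at this

/-- Used with `x` an instance `φ(c)` and `x'` the sentence `∃vφ`; the hypothesis on `x'` is all that
is needed of the quantifier. -/
theorem Der.ex_elim {x' : LT σ} (hS : ∀ b y, (b, y) ∈ S → y ∈ supp {c}ᶜ) (hc : o c = a)
    (hx' : x' ∈ Lang o a) (hxx' : ∀ z ∈ supp {c}ᶜ, x ≤ z → x' ≤ z) (hy : y ∈ supp {c}ᶜ)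
    (h : Der o (insert (a, x) S) b y) : Der o (insert (a, x') S) b y := by
  by_cases hb : a <:+ b
  · obtain ⟨l, rfl⟩ := hb
    exact Der.of_freshConst_tower hx' hxx' hy
      ((h.freshConst_cases hS hc hx' hxx').1 l rfl) h.mem_lang
  · exact (h.freshConst_cases hS hc hx' hxx').2 hb

/-- With no assumption about `c`, a consequence `φ(c)` at its owner already follows from one
derivable element free of `c`, to which generalisation applies. -/
theorem Der.exists_of_freshConst (hS : ∀ b y, (b, y) ∈ S → y ∈ supp {c}ᶜ) (hc : o c = a)
    (h : Der o S a y) : ∃ z ∈ supp {c}ᶜ, Der o S a z ∧ z ≤ y := by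
  obtain ⟨z, hz, h1, h2⟩ := ((h.mono (Set.subset_insert (a, ⊤) _)).freshConst_cases hS hc
    top_mem_supp fun _ _ h => h).1 [] rfl
  exact ⟨z, hz, h1.cut_insert .top, by rwa [inf_top_eq] at h2⟩

/-! ### Assumptions at the root -/

/-- Detours through the tree add nothing: above the root only consequences of boxes are obtained,
and their diamonds already follow at the root. So labelled derivability from the root is ordinary
derivability from finitely many assumptions. -/
theorem Der.root (hS : ∀ b y, (b, y) ∈ S → b = []) (h : Der o S [] y) :
    ∃ l : List (LT σ), (∀ x ∈ l, ([], x) ∈ S) ∧ l.foldr (· ⊓ ·) ⊤ ≤ y := by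
  have hfold : ∀ l l' : List (LT σ),
      (l ++ l').foldr (· ⊓ ·) ⊤ = l.foldr (· ⊓ ·) ⊤ ⊓ l'.foldr (· ⊓ ·) ⊤ := by
    intro l l'
    induction l with
    | nil => simp
    | cons x l ih => simp [ih, inf_assoc]
  have H : TowerBase o []
      {y | ∃ l : List (LT σ), (∀ x ∈ l, ([], x) ∈ S) ∧ l.foldr (· ⊓ ·) ⊤ ≤ y} (fun _ => {⊤}) :=
    { le := by rintro y ⟨l, h1, h2⟩ w hw; exact ⟨l, h1, h2.trans hw⟩
      inf := by
        rintro y ⟨l, h1, h2⟩ y' ⟨l', h1', h2'⟩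
        refine ⟨l ++ l', fun x hx => (List.mem_append.1 hx).elim (h1 x) (h1' x), ?_⟩
        rw [hfold]; exact inf_le_inf h2 h2'
      sub := by rintro _ rfl; exact ⟨[], by simp, le_top⟩
      top_known := fun _ => rfl
      inf_known := by rintro _ _ rfl _ rfl; exact inf_idem _
      dia_known := by
        rintro _ _ _ rfl y _ h
        exact ⟨⊤, h, ldia_top⟩ }
  have hn : ∀ {b : List ι} {P : Prop}, ¬ [] <:+ b → P := fun h => (h List.nil_suffix).elim
  refine (H.der_induction (Q := fun _ _ => True) ?_ ?_ ?_ ?_ ?_ ?_ ?_ ?_ ?_ ?_ h).1 [] rfl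
  · exact fun x hx _ => ⟨[x], by simpa using hx, by simp⟩
  · exact fun i l x hx => by cases hS _ _ hx
  · exact fun _ _ h => hn h
  · exact fun _ _ _ h => hn h
  · exact fun _ h => hn h
  · exact fun _ _ _ h => hn h
  · exact fun _ _ _ h => hn h
  · exact fun _ _ _ h => hn h
  · exact fun _ _ _ h => by cases h
  · exact fun _ _ _ h => by cases h

end Derivability

/-! ## Saturated networks -/

section Networks

/-! ### Countability of the language. -/

instance : Countable (Term σ) := by
  have := σ.countable_const
  refine Function.Surjective.countable (f := (Sum.elim Term.var Term.cst : ℕ ⊕ σ.Const → Term σ)) ?_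
  rintro (x | c)
  · exact ⟨.inl x, rfl⟩
  · exact ⟨.inr c, rfl⟩

/-- The formulas of depth less than a given number. -/
def formulasBelow (σ : Signature.{u}) : ℕ → Set (Formula σ)
  | 0 => ∅
  | n + 1 => Set.range (fun p : Σ P, (Fin (σ.arity P) → Term σ) => Formula.atom p.1 p.2) ∪
      Set.range (fun p : Term σ × Term σ => Formula.eq p.1 p.2) ∪
      Set.image2 .and (formulasBelow σ n) (formulasBelow σ n) ∪
      Set.image2 .or (formulasBelow σ n) (formulasBelow σ n) ∪
      Set.image2 .imp (formulasBelow σ n) (formulasBelow σ n) ∪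
      Formula.box '' formulasBelow σ n ∪ Formula.dia '' formulasBelow σ n ∪
      Set.image2 .all Set.univ (formulasBelow σ n) ∪ Set.image2 .ex Set.univ (formulasBelow σ n) ∪
      {.bot} ∪ formulasBelow σ n

theorem countable_formulasBelow (n : ℕ) : (formulasBelow σ n).Countable := by
  have := σ.countable_pred
  induction n with
  | zero => exact Set.countable_empty
  | succ n ih =>
    have hu : (Set.univ : Set ℕ).Countable := Set.countable_univ
    exact (((((((((((Set.countable_range _).union (Set.countable_range _)).union
      (ih.image2 ih _)).union (ih.image2 ih _)).union (ih.image2 ih _)).union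
      (ih.image _)).union (ih.image _)).union (hu.image2 ih _)).union (hu.image2 ih _)).union
      (Set.countable_singleton _)).union ih)

theorem formulasBelow_mono : Monotone (formulasBelow σ) :=
  monotone_nat_of_le_succ fun _ => Set.subset_union_right

theorem exists_mem_formulasBelow (φ : Formula σ) : ∃ n, φ ∈ formulasBelow σ n := by
  have pair : ∀ {φ ψ : Formula σ}, (∃ n, φ ∈ formulasBelow σ n) → (∃ n, ψ ∈ formulasBelow σ n) →
      ∃ n, φ ∈ formulasBelow σ n ∧ ψ ∈ formulasBelow σ n := by
    rintro φ ψ ⟨n, hn⟩ ⟨m, hm⟩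
    exact ⟨max n m, formulasBelow_mono (le_max_left n m) hn, formulasBelow_mono (le_max_right n m) hm⟩
  induction φ with
  | atom P t => exact ⟨1, by simp [formulasBelow]⟩
  | eq s t => exact ⟨1, by simp [formulasBelow]⟩
  | and φ ψ ih1 ih2 | or φ ψ ih1 ih2 | imp φ ψ ih1 ih2 =>
    obtain ⟨n, hn⟩ := pair ih1 ih2
    exact ⟨n + 1, by simp [formulasBelow, hn]⟩
  | box φ ih | dia φ ih | all x φ ih | ex x φ ih =>
    obtain ⟨n, hn⟩ := ih
    exact ⟨n + 1, by simp [formulasBelow, hn]⟩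
  | bot => exact ⟨1, by simp [formulasBelow]⟩

instance : Countable (Formula σ) := by
  rw [← Set.countable_univ_iff]
  refine (Set.countable_iUnion countable_formulasBelow).mono fun φ _ => ?_
  exact Set.mem_iUnion.2 (exists_mem_formulasBelow φ)

/-! ### Owners, ranks and the supply of fresh constants and nodes. -/

/-- Nodes of the tree. A member of a node is a pair of a rank and an index. -/
abbrev Node : Type := List (ℕ × ℕ)

theorem nonempty_code (σ : Signature.{u}) : Nonempty (σ.Const ≃ Node × ℕ × ℕ) := by
  have := σ.countable_const
  have := σ.infinite_const
  exact nonempty_equiv_of_countable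

/-- An indexing of the constants by an owner, a rank and an index. -/
noncomputable def code (σ : Signature.{u}) : σ.Const ≃ Node × ℕ × ℕ := (nonempty_code σ).some

/-- The node at which a constant is introduced. -/
noncomputable def owner (c : σ.Const) : Node := (code σ c).1

/-- The rank of a constant. -/
noncomputable def rank (c : σ.Const) : ℕ := (code σ c).2.1

/-- The ranks in the node are at most `n`. -/
def InRank (n : ℕ) (a : Node) : Prop := ∀ p ∈ a, p.1 ≤ n

theorem InRank.mono {n m : ℕ} {a : Node} (h : InRank n a) (hnm : n ≤ m) : InRank m a :=
  fun p hp => (h p hp).trans hnm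

/-- The constants of rank at most `n` that are available at the node `a`. -/
def vocab (σ : Signature.{u}) (n : ℕ) (a : Node) : Set σ.Const := {c | owner c <:+ a ∧ rank c ≤ n}

theorem vocab_mono {n m : ℕ} (h : n ≤ m) (a : Node) : vocab σ n a ⊆ vocab σ m a :=
  fun _ hc => ⟨hc.1, hc.2.trans h⟩

theorem vocab_cons (n : ℕ) (i : ℕ × ℕ) (a : Node) : vocab σ n a ⊆ vocab σ n (i :: a) :=
  fun _ hc => ⟨hc.1.trans (List.suffix_cons i a), hc.2⟩

theorem supp_vocab_subset {n : ℕ} {a : Node} : supp (vocab σ n a) ⊆ Lang owner a :=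
  supp_mono fun _ h => h.1

/-- The labelled elements all live at rank at most `n`. -/
def Ranked (n : ℕ) (S : Set (Node × LT σ)) : Prop :=
  ∀ a x, (a, x) ∈ S → InRank n a ∧ x ∈ supp (vocab σ n a)

theorem exists_fresh_const {K : Set σ.Const} (hK : K.Finite) (a : Node) (n : ℕ) :
    ∃ c ∉ K, owner c = a ∧ rank c = n := by
  have hinj : Function.Injective fun j : ℕ => (code σ).symm (a, n, j) := fun j k h => by
    simpa using h
  obtain ⟨_, ⟨j, rfl⟩, hj⟩ := (Set.infinite_range_of_injective hinj).exists_notMem_finite hK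
  exact ⟨_, hj, by simp [owner], by simp [rank]⟩

theorem exists_finite_const_of_finite {F : Set (Node × LT σ)} (hF : F.Finite)
    (h : ∀ p ∈ F, p.2 ∈ supp (Set.univ : Set σ.Const)) :
    ∃ K : Set σ.Const, K.Finite ∧ ∀ p ∈ F, p.2 ∈ supp K := by
  choose! J hJ1 _ hJ2 using fun p hp => exists_finite_supp (h p hp)
  exact ⟨⋃ p ∈ F, J p, hF.biUnion hJ1, fun p hp =>
    supp_mono (Set.subset_biUnion_of_mem hp) (hJ2 p hp)⟩

theorem exists_fresh_node {F : Set Node} (hF : F.Finite) (a : Node) (n : ℕ) :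
    ∃ i : ℕ × ℕ, i.1 = n ∧ ∀ b ∈ F, ¬ i :: a <:+ b := by
  have hfin : (⋃ b ∈ F, {p : ℕ × ℕ | p ∈ b}).Finite := hF.biUnion fun b _ => b.finite_toSet
  have hinj : Function.Injective fun j : ℕ => (n, j) := fun j k h => by simpa using h
  obtain ⟨_, ⟨j, rfl⟩, hj⟩ := (Set.infinite_range_of_injective hinj).exists_notMem_finite hfin
  refine ⟨(n, j), rfl, fun b hb h => hj ?_⟩
  exact Set.mem_biUnion hb (h.subset (List.mem_cons_self))

/-! ### Saturation by enumeration. -/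

/-- The set `T` decides the formula at the node, relative to a goal that is not to be derived. -/
def Decides (T : Set (Node × LT σ)) (n : ℕ) (g : Node) (G : LT σ) (a : Node) (φ : Formula σ)
    (h : IsSentence φ) : Prop :=
  Der owner (insert (a, cls φ h) T) g G ∨ ((a, cls φ h) ∈ T ∧
    (∀ v ψ, φ = .ex v ψ → ∀ hψ : FreeOnly v ψ, ∃ c ∈ vocab σ n a, (a, cls (ψ.inst v c) (hψ.inst c)) ∈ T) ∧
    (∀ ψ, φ = .dia ψ → ∀ hψ : IsSentence ψ, ∃ i, InRank n (i :: a) ∧ (i :: a, cls ψ hψ) ∈ T))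

/-- Finite extensions that do not derive the goal. -/
structure Extends (S : Set (Node × LT σ)) (n : ℕ) (g : Node) (G : LT σ) (F : Set (Node × LT σ)) :
    Prop where
  finite : F.Finite
  ranked : Ranked n F
  not_der : ¬ Der owner (S ∪ F) g G

variable {S F : Set (Node × LT σ)} {n : ℕ} {g a : Node} {G x : LT σ}

theorem Extends.insert (h : Extends S n g G F) (ha : InRank n a) (hx : x ∈ supp (vocab σ n a))
    (hd : ¬ Der owner (insert (a, x) (S ∪ F)) g G) : Extends S n g G (insert (a, x) F) where
  finite := h.finite.insert _
  ranked := by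
    rintro b y (hy | hy)
    · cases hy; exact ⟨ha, hx⟩
    · exact h.ranked b y hy
  not_der := by rwa [Set.union_insert]

/-- One Henkin step. The formula is added unless it yields the goal; an existential or a diamond
then receives a witness of rank `n + 1`. `S` has rank `n` and `F` is finite, so a fresh witness
always exists. -/
theorem Extends.exists_decides (hS : Ranked n S) (hG : G ∈ supp (vocab σ (n + 1) g))
    (h : Extends S (n + 1) g G F) (ha : InRank (n + 1) a)
    {φ : Formula σ} (hφ : IsSentence φ) (hc : consts φ ⊆ vocab σ (n + 1) a) :
    ∃ F', F ⊆ F' ∧ Extends S (n + 1) g G F' ∧ Decides (S ∪ F') (n + 1) g G a φ hφ := by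
  by_cases hd : Der owner (Insert.insert (a, cls φ hφ) (S ∪ F)) g G
  · exact ⟨F, subset_rfl, h, Or.inl hd⟩
  have h1 := h.insert ha (cls_mem_supp hc) hd
  set F₁ := Insert.insert (a, cls φ hφ) F with hF₁
  have hmem : (a, cls φ hφ) ∈ S ∪ F₁ := Or.inr (Or.inl rfl)
  have hder : Der owner (S ∪ F₁) a (cls φ hφ) :=
    .hyp hmem (supp_vocab_subset (cls_mem_supp hc))
  by_cases hex : ∃ v ψ, φ = .ex v ψ
  · obtain ⟨v, ψ, rfl⟩ := hex
    have hψ : FreeOnly v ψ := isSentence_ex.1 hφ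
    obtain ⟨K, hK, hKF⟩ := exists_finite_const_of_finite h1.finite
      fun p hp => supp_mono (Set.subset_univ _) (h1.ranked p.1 p.2 hp).2
    obtain ⟨J, hJ, -, hJG⟩ := exists_finite_supp hG
    obtain ⟨c, hcf, hco, hcr⟩ := exists_fresh_const ((hK.union hJ).union (finite_consts ψ)) a (n + 1)
    simp only [Set.mem_union, not_or] at hcf
    have hcv : c ∈ vocab σ (n + 1) a := ⟨hco ▸ List.suffix_rfl, hcr.le⟩
    have hcψ : consts (ψ.inst v c) ⊆ vocab σ (n + 1) a := fun d hd =>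
      (hasConst_inst hd).elim (fun e => e ▸ hcv) fun h => hc h
    refine ⟨Insert.insert (a, cls (ψ.inst v c) (hψ.inst c)) F₁,
      (Set.subset_insert _ _).trans (Set.subset_insert _ _),
      h1.insert ha (cls_mem_supp hcψ) fun hd' => h1.not_der ?_, Or.inr ⟨Or.inr (Or.inr (Or.inl rfl)), ?_, ?_⟩⟩
    -- If `ψ(c)` led to the goal, so would `∃vψ`, which is already present and can be cut.
    · refine (hd'.ex_elim (c := c) ?_ hco (supp_vocab_subset (cls_mem_supp hc))
        (fun z hz hle => cls_ex_le hψ hcf.2 hz hle)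
        (supp_mono (Set.subset_compl_singleton_iff.2 hcf.1.2) hJG)).cut_insert hder
      rintro b y (hy | hy)
      · refine supp_mono (Set.subset_compl_singleton_iff.2 fun hcb => ?_) (hS b y hy).2
        have := hcb.2
        omega
      · exact supp_mono (Set.subset_compl_singleton_iff.2 hcf.1.1) (hKF _ hy)
    · rintro w χ e hχ
      cases e
      exact ⟨c, hcv, Or.inr (Or.inl rfl)⟩
    · rintro χ e; cases e
  by_cases hdia : ∃ ψ, φ = .dia ψ
  · obtain ⟨ψ, rfl⟩ := hdia
    obtain ⟨i, hi, hif⟩ := exists_fresh_node ((h1.finite.image Prod.fst).insert g) a (n + 1)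
    have hir : InRank (n + 1) (i :: a) := by
      rintro p hp
      rcases List.mem_cons.1 hp with rfl | hp
      · exact hi.le
      · exact ha p hp
    have hψ : cls ψ hφ ∈ supp (vocab σ (n + 1) a) := cls_mem_supp hc
    refine ⟨Insert.insert (i :: a, cls ψ hφ) F₁,
      (Set.subset_insert _ _).trans (Set.subset_insert _ _),
      h1.insert hir (supp_mono (vocab_cons _ i a) hψ) fun hd' => h1.not_der ?_,
      Or.inr ⟨Or.inr (Or.inr (Or.inl rfl)), ?_, ?_⟩⟩
    -- If the assumption at the fresh child led to the goal, so would the diamond at `a`. The goal's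
    -- node was avoided in choosing `i`, so it lies outside the child's cone.
    · refine (hd'.dia_elim ?_ (supp_vocab_subset hψ) (hif g (Or.inl rfl))).cut_insert hder
      rintro b y (hy | hy)
      · intro hb
        have := (hS b y hy).1 i (hb.subset List.mem_cons_self)
        omega
      · exact hif b (Or.inr ⟨_, hy, rfl⟩)
    · rintro w χ e; cases e
    · rintro χ e hχ
      cases e
      exact ⟨i, hir, Or.inr (Or.inl rfl)⟩
  · exact ⟨F₁, Set.subset_insert _ _, h1, Or.inr ⟨hmem, fun v ψ e => (hex ⟨v, ψ, e⟩).elim,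
      fun ψ e => (hdia ⟨ψ, e⟩).elim⟩⟩

theorem Decides.mono {T T' : Set (Node × LT σ)} {φ : Formula σ} {hφ : IsSentence φ}
    (h : Decides T n g G a φ hφ) (hT : T ⊆ T') : Decides T' n g G a φ hφ := by
  refine h.imp (fun h => h.mono (Set.insert_subset_insert hT)) fun ⟨h1, h2, h3⟩ =>
    ⟨hT h1, fun v ψ e hψ => ?_, fun ψ e hψ => ?_⟩
  · obtain ⟨c, hc, h⟩ := h2 v ψ e hψ
    exact ⟨c, hc, hT h⟩
  · obtain ⟨i, hi, h⟩ := h3 ψ e hψ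
    exact ⟨i, hi, hT h⟩

/-- A saturated set of labelled elements at rank `n`. -/
structure Network (σ : Signature.{u}) (n : ℕ) where
  carrier : Set (Node × LT σ)
  ranked : Ranked n carrier
  closed : ∀ a x, InRank n a → x ∈ supp (vocab σ n a) → Der owner carrier a x → (a, x) ∈ carrier
  bot_notMem : ∀ a, (a, ⊥) ∉ carrier
  prime : ∀ a x y, (a, x ⊔ y) ∈ carrier → x ∈ supp (vocab σ n a) → y ∈ supp (vocab σ n a) →
    (a, x) ∈ carrier ∨ (a, y) ∈ carrier
  -- Stated for formulas, since a class in the Lindenbaum algebra does not determine a quantifier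
  -- matrix.
  exists_const : ∀ a v φ (h : FreeOnly v φ), consts φ ⊆ vocab σ n a →
    (a, cls (.ex v φ) (isSentence_ex.2 h)) ∈ carrier →
    ∃ c ∈ vocab σ n a, (a, cls (φ.inst v c) (h.inst c)) ∈ carrier
  exists_child : ∀ a x, (a, ldia x) ∈ carrier → x ∈ supp (vocab σ n a) →
    ∃ i, InRank n (i :: a) ∧ (i :: a, x) ∈ carrier

/-- All pairs of a node and a formula are treated along an enumeration. The goal stays underivable
in the union because derivations use finitely many assumptions, and decisions persist because they
are monotone. -/
theorem exists_decisive (hS : Ranked n S) (hG : G ∈ supp (vocab σ (n + 1) g))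
    (h : ¬ Der owner S g G) : ∃ T, S ⊆ T ∧ Ranked (n + 1) T ∧ ¬ Der owner T g G ∧
      ∀ a φ, InRank (n + 1) a → ∀ hφ : IsSentence φ, consts φ ⊆ vocab σ (n + 1) a →
        Decides T (n + 1) g G a φ hφ := by
  have : Nonempty (Formula σ) := ⟨.bot⟩
  obtain ⟨f, hf⟩ := exists_surjective_nat (Node × Formula σ)
  have step : ∀ (k : ℕ) (F : {F // Extends S (n + 1) g G F}),
      ∃ F' : {F // Extends S (n + 1) g G F}, F.1 ⊆ F'.1 ∧ (InRank (n + 1) (f k).1 →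
        ∀ hφ : IsSentence (f k).2, consts (f k).2 ⊆ vocab σ (n + 1) (f k).1 →
          Decides (S ∪ F'.1) (n + 1) g G (f k).1 (f k).2 hφ) := by
    rintro k ⟨F, hF⟩
    by_cases hk : InRank (n + 1) (f k).1 ∧ ∃ _ : IsSentence (f k).2,
        consts (f k).2 ⊆ vocab σ (n + 1) (f k).1
    · obtain ⟨h1, h2, h3⟩ := hk
      obtain ⟨F', hF', h4, h5⟩ := hF.exists_decides hS hG h1 h2 h3
      exact ⟨⟨F', h4⟩, hF', fun _ _ _ => h5⟩
    · exact ⟨⟨F, hF⟩, subset_rfl, fun h1 h2 h3 => (hk ⟨h1, h2, h3⟩).elim⟩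
  choose next hnext1 hnext2 using step
  let F : ℕ → {F // Extends S (n + 1) g G F} := fun k =>
    Nat.rec ⟨∅, Set.finite_empty, fun _ _ h => h.elim, by rwa [Set.union_empty]⟩ next k
  have hmono : Monotone fun k => S ∪ (F k).1 :=
    monotone_nat_of_le_succ fun k => Set.union_subset_union_right S (hnext1 k (F k))
  refine ⟨⋃ k, S ∪ (F k).1, fun p hp => Set.mem_iUnion.2 ⟨0, Or.inl hp⟩, ?_, ?_, ?_⟩
  · intro a x hx
    obtain ⟨k, hk | hk⟩ := Set.mem_iUnion.1 hx
    · exact ⟨(hS a x hk).1.mono n.le_succ, supp_mono (vocab_mono n.le_succ a) (hS a x hk).2⟩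
    · exact (F k).2.ranked a x hk
  · intro hd
    obtain ⟨k, hk⟩ := hd.exists_of_iUnion hmono
    exact (F k).2.not_der hk
  · intro a φ ha hφ hc
    obtain ⟨k, hk⟩ := hf (a, φ)
    have := hnext2 k (F k)
    rw [hk] at this
    -- The pair numbered `k` is decided in passing from stage `k` to stage `k + 1`.
    exact (this ha hφ hc).mono (Set.subset_iUnion (fun k => S ∪ (F k).1) (k + 1))

/-- Every underivable goal is omitted by a saturated network of the next rank. -/
theorem exists_network (hS : Ranked n S)
    (hG : G ∈ supp (vocab σ (n + 1) g)) (h : ¬ Der owner S g G) :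
    ∃ N : Network σ (n + 1), S ⊆ N.carrier ∧ (g, G) ∉ N.carrier := by
  obtain ⟨T, hST, hT, hd, hdec⟩ := exists_decisive hS hG h
  have hlang : ∀ {a x}, (a, x) ∈ T → Der owner T a x := fun hx =>
    .hyp hx (supp_vocab_subset (hT _ _ hx).2)
  have hins : ∀ {a x}, InRank (n + 1) a → x ∈ supp (vocab σ (n + 1) a) → (a, x) ∉ T →
      Der owner (insert (a, x) T) g G := by
    rintro a _ ha ⟨φ, hφ, hc, rfl⟩ hx
    exact (hdec a φ ha hφ hc).resolve_right fun h => hx h.1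
  refine ⟨⟨T, hT, ?_, ?_, ?_, ?_, ?_⟩, hST, fun h => hd (hlang h)⟩
  · intro a x ha hx hder
    by_contra hxT
    exact hd ((hins ha hx hxT).cut_insert hder)
  · intro a ha
    exact hd (((hlang ha).bot g).le bot_le (supp_vocab_subset hG))
  · intro a x y hxy hx hy
    by_contra hcon
    rw [not_or] at hcon
    have ha := (hT _ _ hxy).1
    exact hd (((hins ha hx hcon.1).sup (supp_vocab_subset hx) (supp_vocab_subset hy)
      (hins ha hy hcon.2)).cut_insert (hlang hxy))
  · intro a v φ hφ hc hex
    rcases hdec a (.ex v φ) (hT _ _ hex).1 (isSentence_ex.2 hφ) hc with h | h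
    · exact (hd (h.cut_insert (hlang hex))).elim
    · exact h.2.1 v φ rfl hφ
  · rintro a _ hdia ⟨φ, hφ, hc, rfl⟩
    rcases hdec a (.dia φ) (hT _ _ hdia).1 hφ hc with h | h
    · exact (hd (h.cut_insert (hlang hdia))).elim
    · exact h.2.2 φ rfl hφ

end Networks

/-! ## The canonical model -/

section CanonicalModel

/-! ### Equations and atoms. -/

/-- The class of an equation between constants. -/
def eqCls (c d : σ.Const) : LT σ :=
  cls (.eq (.cst c) (.cst d)) (Set.eq_empty_of_forall_notMem fun _ h => by simp [fv] at h)

/-- The class of an atomic sentence. -/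
def atomCls (P : σ.Pred) (t : Fin (σ.arity P) → σ.Const) : LT σ :=
  cls (.atom P fun i => .cst (t i)) (Set.eq_empty_of_forall_notMem fun _ h => by simp [fv] at h)

theorem eqCls_mem_supp {K : Set σ.Const} {c d : σ.Const} (hc : c ∈ K) (hd : d ∈ K) :
    eqCls c d ∈ supp K := cls_mem_supp fun e he => by
  rcases he with he | he <;> cases he <;> assumption

theorem atomCls_mem_supp {K : Set σ.Const} {P : σ.Pred} {t : Fin (σ.arity P) → σ.Const}
    (h : ∀ i, t i ∈ K) : atomCls P t ∈ supp K := cls_mem_supp fun e he => by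
  obtain ⟨i, hi⟩ := he
  cases hi; exact h i

theorem eqCls_self (c : σ.Const) : eqCls c c = ⊤ :=
  top_unique (Sentence.le_of_thm (ψ := ⊤)
    (φ := ⟨_, Set.eq_empty_of_forall_notMem fun _ h => by simp [fv] at h⟩) (Thm.id_ref c))

theorem eqCls_inf_le {φ : Formula σ} {v : ℕ} (h : FreeOnly v φ) (hm : ModalFree φ)
    (c d : σ.Const) :
    eqCls c d ⊓ cls (φ.inst v c) (h.inst c) ≤ cls (φ.inst v d) (h.inst d) :=
  le_himp_iff.1 (cls_le.2 (Thm.id_sub v c d h hm) :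
    eqCls c d ≤ cls (φ.inst v c) (h.inst c) ⇨ cls (φ.inst v d) (h.inst d))

theorem eqCls_symm (c d : σ.Const) : eqCls c d ≤ eqCls d c := by
  have := eqCls_inf_le (φ := .eq (.var 0) (.cst c)) (v := 0)
    (fun y hy => by simpa [fv, eq_comm] using hy) trivial c d
  have h1 : eqCls c d ⊓ eqCls c c ≤ eqCls d c := by
    simpa only [eqCls, Formula.inst, Term.inst, if_true] using this
  rwa [eqCls_self, inf_top_eq] at h1

theorem eqCls_trans (c d e : σ.Const) : eqCls c d ⊓ eqCls d e ≤ eqCls c e := by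
  have := eqCls_inf_le (φ := .eq (.cst c) (.var 0)) (v := 0)
    (fun y hy => by simpa [fv, eq_comm] using hy) trivial d e
  have h1 : eqCls d e ⊓ eqCls c d ≤ eqCls c e := by
    simpa only [eqCls, Formula.inst, Term.inst, if_true] using this
  rwa [inf_comm]

/-- Substitution in the atom with the variable `v₀` in place `i`; one argument is exchanged at a
time. -/
theorem eqCls_inf_atomCls_le (P : σ.Pred) (t : Fin (σ.arity P) → σ.Const) (i : Fin (σ.arity P))
    (d : σ.Const) : eqCls (t i) d ⊓ atomCls P t ≤ atomCls P (Function.update t i d) := by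
  classical
  let s : Fin (σ.arity P) → Term σ := Function.update (fun j => .cst (t j)) i (.var 0)
  have hs : ∀ c, (fun j => (s j).inst 0 c) = fun j => Term.cst (Function.update t i c j) := by
    intro c
    funext j
    by_cases hj : j = i
    · subst hj; simp [s, Term.inst]
    · simp [s, Term.inst, hj]
  have hf : FreeOnly 0 (Formula.atom P s) := by
    rintro y ⟨j, hj⟩
    by_cases hji : j = i
    · subst hji; simpa [s, eq_comm] using hj
    · simp [s, hji] at hj
  have := eqCls_inf_le hf trivial (t i) d
  simp only [Formula.inst, hs, Function.update_eq_self] at this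
  exact this

/-! ### Worlds, frame and interpretation. -/

/-- An injection of the constants into those introduced at the root. -/
noncomputable def toRoot (c : σ.Const) : σ.Const := (code σ).symm ([], 0, Encodable.encode (code σ c))

theorem toRoot_injective : Function.Injective (toRoot : σ.Const → σ.Const) := fun c d h => by
  simpa [toRoot] using h

theorem toRoot_mem_vocab (c : σ.Const) (n : ℕ) (a : Node) : toRoot c ∈ vocab σ n a :=
  ⟨by simp [toRoot, owner], by simp [toRoot, FOFS.rank]⟩

/-- The worlds of the canonical model. -/
structure World (σ : Signature.{u}) where
  rank : ℕ
  net : Network σ rank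
  node : Node
  inRank : InRank rank node

namespace World

/-- The constants available at a world. -/
def dom (w : World σ) : Set σ.Const := vocab σ w.rank w.node

/-- The elements forced at a world. -/
def theory (w : World σ) : Set (LT σ) := {x | (w.node, x) ∈ w.net.carrier}

variable {w v : World σ} {x y : LT σ}

theorem mem_of_der (hx : x ∈ supp w.dom) (h : Der owner w.net.carrier w.node x) : x ∈ w.theory :=
  w.net.closed _ _ w.inRank hx h

theorem mem_supp (hx : x ∈ w.theory) : x ∈ supp w.dom := (w.net.ranked _ _ hx).2

theorem der (hx : x ∈ w.theory) : Der owner w.net.carrier w.node x :=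
  .hyp hx (supp_vocab_subset (mem_supp hx))

theorem mem_of_le (hx : x ∈ w.theory) (h : x ≤ y) (hy : y ∈ supp w.dom) : y ∈ w.theory :=
  mem_of_der hy ((der hx).le h (supp_vocab_subset hy))

theorem inf_mem (hx : x ∈ w.theory) (hy : y ∈ w.theory) : x ⊓ y ∈ w.theory :=
  mem_of_der (inf_mem_supp (mem_supp hx) (mem_supp hy)) ((der hx).inf (der hy))

/-- The intuitionistic order. -/
def Le (w v : World σ) : Prop :=
  w.rank ≤ v.rank ∧ w.node = v.node ∧ w.net.carrier ⊆ v.net.carrier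

/-- The modal relation. -/
def Rel (w v : World σ) : Prop :=
  ∃ (b : Node) (h : InRank w.rank b), v = ⟨w.rank, w.net, b, h⟩ ∧
    (b = w.node ∨ ∃ i, b = i :: w.node)

theorem Le.dom_subset (h : Le w v) : w.dom ⊆ v.dom := by
  unfold dom; rw [h.2.1]; exact vocab_mono h.1 _

theorem Le.theory_subset (h : Le w v) : w.theory ⊆ v.theory := by
  unfold theory; rw [h.2.1]; exact fun x hx => h.2.2 hx

theorem Rel.dom_subset (h : Rel w v) : w.dom ⊆ v.dom := by
  obtain ⟨b, hb, rfl, rfl | ⟨i, rfl⟩⟩ := h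
  · exact subset_rfl
  · exact vocab_cons _ _ _

theorem Rel.refl (w : World σ) : Rel w w := ⟨w.node, w.inRank, rfl, Or.inl rfl⟩

theorem le_antisymm (h : Le w v) (h' : Le v w) : w = v := by
  obtain ⟨n, ⟨S, _, _, _, _, _, _⟩, a, ha⟩ := w
  obtain ⟨m, ⟨T, _, _, _, _, _, _⟩, b, hb⟩ := v
  obtain rfl : n = m := Nat.le_antisymm h.1 h'.1
  obtain rfl : a = b := h.2.1
  obtain rfl : S = T := Set.Subset.antisymm h.2.2 h'.2.2
  rfl

end World

open World in
/-- The frame of the canonical model. -/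
def canonicalFrame (σ : Signature.{u}) : Frame.{u} where
  W := World σ
  le := Le
  M := Rel
  le_refl _ := ⟨le_rfl, rfl, subset_rfl⟩
  le_trans _ _ _ h h' := ⟨h.1.trans h'.1, h.2.1.trans h'.2.1, h.2.2.trans h'.2.2⟩
  le_antisymm _ _ := World.le_antisymm
  -- In both conditions the completing world is the larger network seen from the other node; bounds
  -- on ranks survive enlargement.
  fc1 := by
    rintro w _ v₁ ⟨b, hb, rfl, h⟩ h'
    have hb' : b = v₁.node := h'.2.1
    have hw : InRank v₁.rank w.node := w.inRank.mono h'.1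
    exact ⟨⟨v₁.rank, v₁.net, w.node, hw⟩, ⟨h'.1, rfl, h'.2.2⟩, v₁.node, v₁.inRank, rfl, hb' ▸ h⟩
  fc2 := by
    rintro w _ w₁ ⟨b, hb, rfl, h⟩ h'
    exact ⟨⟨w₁.rank, w₁.net, b, hb.mono h'.1⟩, ⟨h'.1, rfl, h'.2.2⟩, b, hb.mono h'.1, rfl,
      h'.2.1 ▸ h⟩
  D := σ.Const
  dom := dom
  dom_le _ _ := Le.dom_subset
  dom_M _ _ := Rel.dom_subset
  eqv w c d := c ∈ w.dom ∧ d ∈ w.dom ∧ eqCls c d ∈ w.theory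
  eqv_dom _ _ _ h := ⟨h.1, h.2.1⟩
  eqv_refl w c hc := ⟨hc, hc, mem_of_der (eqCls_mem_supp hc hc) ((eqCls_self c).symm ▸ .top)⟩
  eqv_symm w c d h := ⟨h.2.1, h.1, mem_of_le h.2.2 (eqCls_symm c d) (eqCls_mem_supp h.2.1 h.1)⟩
  eqv_trans w c d e h h' := ⟨h.1, h'.2.1, mem_of_le (inf_mem h.2.2 h'.2.2) (eqCls_trans c d e)
    (eqCls_mem_supp h.1 h'.2.1)⟩
  eqv_le w v c d h h' := ⟨h.dom_subset h'.1, h.dom_subset h'.2.1, h.theory_subset h'.2.2⟩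

theorem canonicalFrame_mem : canonicalFrame σ ∈ reflexiveFrames.{u} := World.Rel.refl

theorem atomCls_mem_of_eqCls {w : World σ} {P : σ.Pred} {s t : Fin (σ.arity P) → σ.Const}
    (h : ∀ i, s i ∈ w.dom ∧ t i ∈ w.dom ∧ eqCls (s i) (t i) ∈ w.theory)
    (hs : atomCls P s ∈ w.theory) : atomCls P t ∈ w.theory := by
  classical
  -- The arguments are exchanged along a growing finite set of positions.
  have key : ∀ K : Finset (Fin (σ.arity P)), atomCls P (K.piecewise t s) ∈ w.theory := by
    intro K
    induction K using Finset.induction_on with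
    | empty => simpa using hs
    | insert i K hi ih =>
      have hmem : ∀ j, (Function.update (K.piecewise t s) i (t i)) j ∈ w.dom := by
        intro j
        by_cases hj : j = i
        · subst hj; simpa using (h j).2.1
        · by_cases hjK : j ∈ K
          · simpa [hj, hjK] using (h j).2.1
          · simpa [hj, hjK] using (h j).1
      have hle := eqCls_inf_atomCls_le P (K.piecewise t s) i (t i)
      rw [Finset.piecewise_eq_of_notMem _ _ _ hi] at hle
      rw [Finset.piecewise_insert]
      exact World.mem_of_le (World.inf_mem (h i).2.2 ih) hle (atomCls_mem_supp hmem)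
  simpa using key Finset.univ

/-- The canonical interpretation. -/
noncomputable def canonicalInterpretation (σ : Signature.{u}) :
    Interpretation σ (canonicalFrame σ) where
  cst := toRoot
  cst_mem c w := toRoot_mem_vocab c w.rank w.node
  rel w P := {t | (∀ i, t i ∈ w.dom) ∧ atomCls P t ∈ w.theory}
  rel_dom _ _ _ h := h.1
  rel_le _ _ _ h _ ht := ⟨fun i => h.dom_subset (ht.1 i), h.theory_subset ht.2⟩
  rel_eqv _ _ _ _ h ht := ⟨fun i => (h i).2.1, atomCls_mem_of_eqCls h ht.2⟩

/-- The class of a formula under an assignment of constants to the variables. -/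
noncomputable def val (g : ℕ → σ.Const) (φ : Formula σ) : LT σ :=
  cls (φ.close toRoot fun x => some (g x)) (isSentence_close toRoot g φ)

/-- The matrix of a quantified formula under an assignment of constants to the variables. -/
noncomputable def matrix (g : ℕ → σ.Const) (x : ℕ) (φ : Formula σ) : Formula σ :=
  φ.close toRoot (Function.update (fun x => some (g x)) x none)

theorem freeOnly_matrix (g : ℕ → σ.Const) (x : ℕ) (φ : Formula σ) : FreeOnly x (matrix g x φ) :=
  freeOnly_close toRoot g x φ

/-- Semantic update of an assignment matches syntactic instantiation of the matrix, which links the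
quantifier clauses to the witness conditions. -/
theorem val_update (g : ℕ → σ.Const) (x : ℕ) (c : σ.Const) (φ : Formula σ) :
    val (Function.update g x c) φ =
      cls ((matrix g x φ).inst x c) ((freeOnly_matrix g x φ).inst c) := by
  refine cls_congr ?_ _
  rw [matrix, inst_close _ (by simp)]
  congr 1
  funext y
  by_cases hy : y = x
  · subst hy; simp
  · simp [hy]

theorem val_all (g : ℕ → σ.Const) (x : ℕ) (φ : Formula σ) :
    val g (.all x φ) = cls (.all x (matrix g x φ)) (isSentence_all.2 (freeOnly_matrix g x φ)) := rfl

theorem val_ex (g : ℕ → σ.Const) (x : ℕ) (φ : Formula σ) :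
    val g (.ex x φ) = cls (.ex x (matrix g x φ)) (isSentence_ex.2 (freeOnly_matrix g x φ)) := rfl

theorem val_mem_supp {g : ℕ → σ.Const} {n : ℕ} {a : Node} (hg : ∀ x, g x ∈ vocab σ n a)
    (φ : Formula σ) : val g φ ∈ supp (vocab σ n a) := by
  refine cls_mem_supp fun c hc => ?_
  rcases hasConst_close hc with ⟨d, rfl⟩ | ⟨x, hx⟩
  · exact toRoot_mem_vocab d n a
  · cases hx; exact hg x

theorem consts_matrix {g : ℕ → σ.Const} {n : ℕ} {a : Node} (hg : ∀ x, g x ∈ vocab σ n a) (x : ℕ)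
    (φ : Formula σ) : consts (matrix g x φ) ⊆ vocab σ n a := by
  intro c hc
  rcases hasConst_close hc with ⟨d, rfl⟩ | ⟨y, hy⟩
  · exact toRoot_mem_vocab d n a
  · by_cases hyx : y = x
    · simp [hyx] at hy
    · simp only [ne_eq, hyx, not_false_eq_true, Function.update_of_ne, Option.some.injEq] at hy
      exact hy ▸ hg y

theorem close_toRoot_term (g : ℕ → σ.Const) (t : Term σ) :
    t.close toRoot (fun x => some (g x)) = .cst ((canonicalInterpretation σ).den g t) := by
  cases t <;> rfl

theorem den_mem {g : ℕ → σ.Const} {w : World σ} (hg : ∀ x, g x ∈ w.dom) (t : Term σ) :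
    (canonicalInterpretation σ).den g t ∈ w.dom := by
  cases t with
  | var x => exact hg x
  | cst c => exact toRoot_mem_vocab c _ _

theorem ranked_insert {w : World σ} {x : LT σ} (hx : x ∈ supp w.dom) :
    Ranked w.rank (insert (w.node, x) w.net.carrier) := by
  rintro a y (h | h)
  · cases h; exact ⟨w.inRank, hx⟩
  · exact w.net.ranked a y h

/-! ### Counterexample worlds for implication, box and universal quantifier. -/

namespace World

variable {w : World σ} {x y : LT σ}

/-- The extension of a world by a network of the next rank. -/
def extend (w : World σ) (N : Network σ (w.rank + 1)) : World σ :=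
  ⟨w.rank + 1, N, w.node, w.inRank.mono (Nat.le_succ _)⟩

theorem le_extend {N : Network σ (w.rank + 1)} (h : w.net.carrier ⊆ N.carrier) :
    Le w (w.extend N) := ⟨Nat.le_succ _, rfl, h⟩

/-- By deduction, adding `x` at the node does not yield `y` there; saturate at the next rank with
`y` as goal. -/
theorem exists_le_of_himp_notMem (hx : x ∈ supp w.dom) (hy : y ∈ supp w.dom)
    (h : x ⇨ y ∉ w.theory) : ∃ v, Le w v ∧ x ∈ v.theory ∧ y ∉ v.theory := by
  have hd : ¬ Der owner (insert (w.node, x) w.net.carrier) w.node y := fun hd =>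
    h (mem_of_der (himp_mem_supp hx hy) (hd.himp (supp_vocab_subset hx)))
  obtain ⟨N, hN, hyN⟩ := exists_network (ranked_insert hx)
    (supp_mono (vocab_mono (Nat.le_succ _) _) hy) hd
  exact ⟨w.extend N, le_extend ((Set.subset_insert _ _).trans hN), hN (Or.inl rfl), hyN⟩

/-- A child of the next rank carries no assumption, so `Der.box_intro` keeps `x` underivable there.
The refuting successor lives in an enlarged network, as the order before `M` in the clause for `□`
permits. -/
theorem exists_rel_of_lbox_notMem (hx : x ∈ supp w.dom) (h : lbox x ∉ w.theory) :
    ∃ w₁ v, Le w w₁ ∧ Rel w₁ v ∧ x ∉ v.theory := by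
  let b : Node := (w.rank + 1, 0) :: w.node
  have hb : InRank (w.rank + 1) b := fun p hp => by
    rcases List.mem_cons.1 hp with rfl | hp
    · exact le_rfl
    · exact (w.inRank p hp).trans (Nat.le_succ _)
  have hd : ¬ Der owner w.net.carrier b x := fun hd => by
    refine h (mem_of_der (lbox_mem_supp hx) (hd.box_intro (fun c y hc hbc => ?_)
      (supp_vocab_subset hx)))
    have := (w.net.ranked c y hc).1 _ (hbc.subset List.mem_cons_self)
    simp at this
  obtain ⟨N, hN, hyN⟩ := exists_network w.net.ranked
    (supp_mono ((vocab_mono (Nat.le_succ _) _).trans (vocab_cons _ _ _)) hx) hd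
  exact ⟨w.extend N, ⟨w.rank + 1, N, b, hb⟩, le_extend hN, ⟨b, hb, rfl, Or.inr ⟨_, rfl⟩⟩, hyN⟩

/-- A constant of the next rank owned by the node is absent from the network. If the instance at it
were derivable, generalisation would give the universal sentence. -/
theorem exists_const_of_all_notMem {φ : Formula σ} {v : ℕ} (hφ : FreeOnly v φ)
    (hc : consts φ ⊆ w.dom) (h : cls (.all v φ) (isSentence_all.2 hφ) ∉ w.theory) :
    ∃ w₁, Le w w₁ ∧ ∃ c ∈ w₁.dom, cls (φ.inst v c) (hφ.inst c) ∉ w₁.theory := by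
  obtain ⟨c, -, hco, hcr⟩ := exists_fresh_const (σ := σ) Set.finite_empty w.node (w.rank + 1)
  have hfresh : ∀ n a, n ≤ w.rank → c ∉ vocab σ n a := fun n a hn hca => by
    have := hca.2
    omega
  have hcv : c ∈ vocab σ (w.rank + 1) w.node := ⟨hco ▸ List.suffix_rfl, hcr.le⟩
  have hd : ¬ Der owner w.net.carrier w.node (cls (φ.inst v c) (hφ.inst c)) := fun hd => by
    obtain ⟨z, hz, h1, h2⟩ := hd.exists_of_freshConst (fun b y hy =>
      supp_mono (Set.subset_compl_singleton_iff.2 (hfresh _ b le_rfl)) (w.net.ranked b y hy).2) hco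
    have hall : cls (.all v φ) (isSentence_all.2 hφ) ∈ supp w.dom := cls_mem_supp hc
    exact h (mem_of_der hall (h1.le (le_cls_all hφ (fun hcφ => hfresh _ _ le_rfl (hc hcφ)) hz h2)
      (supp_vocab_subset hall)))
  obtain ⟨N, hN, hyN⟩ := exists_network w.net.ranked (cls_mem_supp fun d hd =>
    (hasConst_inst hd).elim (fun e => e ▸ hcv) fun h => vocab_mono (Nat.le_succ _) _ (hc h)) hd
  exact ⟨w.extend N, le_extend hN, c, hcv, hyN⟩

end World

open World in
/-- The truth lemma. -/
theorem sat_iff (φ : Formula σ) (w : World σ) (g : ℕ → σ.Const) (hg : ∀ x, g x ∈ w.dom) :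
    (canonicalInterpretation σ).Sat w g φ ↔ val g φ ∈ w.theory := by
  induction φ generalizing w g with
  | atom P t =>
    have : val g (.atom P t) = atomCls P fun i => (canonicalInterpretation σ).den g (t i) :=
      cls_congr (by simp only [Formula.close, close_toRoot_term]) _
    rw [this]
    exact ⟨fun h => h.2, fun h => ⟨fun i => den_mem hg (t i), h⟩⟩
  | eq s t =>
    have : val g (.eq s t) = eqCls ((canonicalInterpretation σ).den g s)
        ((canonicalInterpretation σ).den g t) :=
      cls_congr (by simp only [Formula.close, close_toRoot_term]) _
    rw [this]
    exact ⟨fun h => h.2.2, fun h => ⟨den_mem hg s, den_mem hg t, h⟩⟩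
  | and φ ψ ih1 ih2 =>
    change _ ∧ _ ↔ val g φ ⊓ val g ψ ∈ w.theory
    rw [ih1 w g hg, ih2 w g hg]
    exact ⟨fun h => inf_mem h.1 h.2, fun h => ⟨mem_of_le h inf_le_left (val_mem_supp hg φ),
      mem_of_le h inf_le_right (val_mem_supp hg ψ)⟩⟩
  | or φ ψ ih1 ih2 =>
    change _ ∨ _ ↔ val g φ ⊔ val g ψ ∈ w.theory
    rw [ih1 w g hg, ih2 w g hg]
    have hs : val g φ ⊔ val g ψ ∈ supp w.dom := sup_mem_supp (val_mem_supp hg φ) (val_mem_supp hg ψ)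
    exact ⟨fun h => h.elim (fun h => mem_of_le h le_sup_left hs) fun h => mem_of_le h le_sup_right hs,
      fun h => w.net.prime _ _ _ h (val_mem_supp hg φ) (val_mem_supp hg ψ)⟩
  | imp φ ψ ih1 ih2 =>
    change (∀ w₁ : World σ, Le w w₁ → _ → _) ↔ val g φ ⇨ val g ψ ∈ w.theory
    constructor
    · intro h
      by_contra hcon
      obtain ⟨v, hv, h1, h2⟩ := exists_le_of_himp_notMem (val_mem_supp hg φ) (val_mem_supp hg ψ) hcon
      have hgv := fun x => hv.dom_subset (hg x)
      exact h2 ((ih2 v g hgv).1 (h v hv ((ih1 v g hgv).2 h1)))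
    · intro h v hv h1
      have hgv := fun x => hv.dom_subset (hg x)
      rw [ih1 v g hgv] at h1
      rw [ih2 v g hgv]
      exact mem_of_le (inf_mem (hv.theory_subset h) h1) himp_inf_le (val_mem_supp hgv ψ)
  | box φ ih =>
    change (∀ w₁ v : World σ, Le w w₁ → Rel w₁ v → _) ↔ lbox (val g φ) ∈ w.theory
    constructor
    · intro h
      by_contra hcon
      obtain ⟨w₁, v, h1, h2, h3⟩ := exists_rel_of_lbox_notMem (val_mem_supp hg φ) hcon
      exact h3 ((ih v g fun x => h2.dom_subset (h1.dom_subset (hg x))).1 (h w₁ v h1 h2))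
    · intro h w₁ v h1 h2
      have hg₁ := fun x => h1.dom_subset (hg x)
      have hgv := fun x => h2.dom_subset (hg₁ x)
      rw [ih v g hgv]
      have h' := h1.theory_subset h
      -- Either the step is reflexive and `□φ → φ` applies, or it goes to a child and the box rule
      -- of `Der` applies.
      obtain ⟨b, hb, rfl, rfl | ⟨i, rfl⟩⟩ := h2
      · exact mem_of_le h' (lbox_le _) (val_mem_supp hgv φ)
      · exact mem_of_der (val_mem_supp hgv φ) ((der h').box (supp_vocab_subset (val_mem_supp hg₁ φ)))
  | dia φ ih =>
    change (∃ v : World σ, Rel w v ∧ _) ↔ ldia (val g φ) ∈ w.theory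
    constructor
    · rintro ⟨v, hv, h⟩
      rw [ih v g fun x => hv.dom_subset (hg x)] at h
      have hs := ldia_mem_supp (val_mem_supp hg φ)
      obtain ⟨b, hb, rfl, rfl | ⟨i, rfl⟩⟩ := hv
      · exact mem_of_le h (le_ldia _) hs
      · exact mem_of_der hs ((der h).dia (supp_vocab_subset (val_mem_supp hg φ)))
    · intro h
      obtain ⟨i, hi, h'⟩ := w.net.exists_child _ _ h (val_mem_supp hg φ)
      have hv : Rel w ⟨w.rank, w.net, i :: w.node, hi⟩ := ⟨_, hi, rfl, Or.inr ⟨i, rfl⟩⟩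
      exact ⟨_, hv, (ih _ g fun x => hv.dom_subset (hg x)).2 h'⟩
  | all x φ ih =>
    change (∀ w₁ : World σ, Le w w₁ → ∀ a ∈ w₁.dom, _) ↔ _
    have hupd : ∀ (w₁ : World σ), Le w w₁ → ∀ a ∈ w₁.dom, ∀ y, Function.update g x a y ∈ w₁.dom := by
      intro w₁ h1 a ha y
      by_cases hy : y = x
      · subst hy; simpa using ha
      · simpa [hy] using h1.dom_subset (hg y)
    rw [val_all]
    constructor
    · intro h
      by_contra hcon
      obtain ⟨w₁, h1, c, hc, h2⟩ := exists_const_of_all_notMem (freeOnly_matrix g x φ)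
        (consts_matrix hg x φ) hcon
      rw [← val_update] at h2
      exact h2 ((ih w₁ _ (hupd w₁ h1 c hc)).1 (h w₁ h1 c hc))
    · intro h w₁ h1 a ha
      refine (ih w₁ _ (hupd w₁ h1 a ha)).2 (mem_of_le (h1.theory_subset h) ?_
        (val_mem_supp (hupd w₁ h1 a ha) φ))
      rw [val_update]
      exact cls_all_le (freeOnly_matrix g x φ) a
  | ex x φ ih =>
    change (∃ a ∈ w.dom, _) ↔ _
    have hupd : ∀ a ∈ w.dom, ∀ y, Function.update g x a y ∈ w.dom := by
      intro a ha y
      by_cases hy : y = x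
      · subst hy; simpa using ha
      · simpa [hy] using hg y
    rw [val_ex]
    constructor
    · rintro ⟨a, ha, h⟩
      have h' := (ih w _ (hupd a ha)).1 h
      rw [val_update] at h'
      exact mem_of_le h' (le_cls_ex (freeOnly_matrix g x φ) a) (val_mem_supp hg (.ex x φ))
    · intro h
      obtain ⟨c, hc, h'⟩ := w.net.exists_const _ x _ (freeOnly_matrix g x φ) (consts_matrix hg x φ) h
      refine ⟨c, hc, (ih w _ (hupd c hc)).2 ?_⟩
      rw [val_update]
      exact h'
  | bot => exact ⟨fun h => h.elim, fun h => w.net.bot_notMem _ h⟩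

theorem val_of_isSentence {φ : Formula σ} (h : IsSentence φ) (g : ℕ → σ.Const) :
    val g φ = cls (φ.map toRoot) (isSentence_map.2 h) :=
  cls_congr (h.close_eq_map _ _) _

end CanonicalModel

/-! ## Completeness -/

/-- Reads a finite meet of classes back as a conjunction of members of `Γ` before renaming, so that
the renaming can be undone on a single implication. -/
theorem exists_list_of_foldr_le {Γ : Set (Formula σ)} (hΓ : ∀ γ ∈ Γ, γ.IsSentence)
    (ρ : σ.Const → σ.Const) (l : List (LT σ))
    (hl : ∀ x ∈ l, ∃ γ, ∃ hγ : γ ∈ Γ, x = cls (γ.map ρ) (isSentence_map.2 (hΓ γ hγ))) :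
    ∃ l' : List (Formula σ), (∀ γ ∈ l', γ ∈ Γ) ∧ ∃ h : IsSentence ((conj l').map ρ),
      cls ((conj l').map ρ) h = l.foldr (· ⊓ ·) ⊤ := by
  induction l with
  | nil => exact ⟨[], by simp, isSentence_top, rfl⟩
  | cons x l ih =>
    obtain ⟨γ, hγ, rfl⟩ := hl x (by simp)
    obtain ⟨l', h1, h2, h3⟩ := ih fun y hy => hl y (by simp [hy])
    refine ⟨γ :: l', ?_, isSentence_and.2 ⟨isSentence_map.2 (hΓ γ hγ), h2⟩, ?_⟩
    · intro δ hδ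
      rcases List.mem_cons.1 hδ with rfl | hδ
      · exact hγ
      · exact h1 δ hδ
    · rw [List.foldr_cons, ← h3]; rfl

end FOFS

theorem mainTheorem7 (σ : FOFS.Signature.{u}) (Γ : Set (FOFS.Formula σ))
    (hΓ : ∀ γ ∈ Γ, γ.IsSentence) (φ : FOFS.Formula σ) (hφ : φ.IsSentence)
    (h : FOFS.Entails FOFS.reflexiveFrames.{u} Γ φ) :
    FOFS.Provable (FOFS.axiomsT σ) Γ φ := by
  let S : Set (FOFS.Node × FOFS.LT σ) := {p | p.1 = [] ∧ ∃ γ, ∃ hγ : γ ∈ Γ,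
    p.2 = FOFS.cls (γ.map FOFS.toRoot) (FOFS.isSentence_map.2 (hΓ γ hγ))}
  obtain ⟨c⟩ : Nonempty σ.Const := σ.infinite_const.nonempty
  -- Any assignment serves for sentences; this one takes values in the domain of every world.
  let g : ℕ → σ.Const := fun _ => FOFS.toRoot c
  have hg : ∀ n a x, g x ∈ FOFS.vocab σ n a := fun n a _ => FOFS.toRoot_mem_vocab c n a
  have hsupp : ∀ n a (ψ : FOFS.Formula σ) (hψ : ψ.IsSentence),
      FOFS.cls (ψ.map FOFS.toRoot) (FOFS.isSentence_map.2 hψ) ∈ FOFS.supp (FOFS.vocab σ n a) := by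
    intro n a ψ hψ
    rw [← FOFS.val_of_isSentence hψ g]
    exact FOFS.val_mem_supp (hg n a) ψ
  have hS : FOFS.Ranked 0 S := by
    rintro a x ⟨rfl, γ, hγ, rfl⟩
    exact ⟨fun p hp => by simp at hp, hsupp _ _ γ (hΓ γ hγ)⟩
  -- Otherwise the root of a network of rank 1 containing the renamed `Γ` and omitting the renamed
  -- `φ` would be a countermodel on a reflexive frame.
  have hder : FOFS.Der FOFS.owner S [] (FOFS.cls (φ.map FOFS.toRoot) (FOFS.isSentence_map.2 hφ)) := by
    by_contra hd
    obtain ⟨N, hN, hφN⟩ := FOFS.exists_network hS (hsupp _ _ φ hφ) hd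
    let w : FOFS.World σ := ⟨1, N, [], fun p hp => by simp at hp⟩
    have htrue : ∀ ψ (hψ : ψ.IsSentence), (FOFS.canonicalInterpretation σ).TrueAt w ψ ↔
        FOFS.cls (ψ.map FOFS.toRoot) (FOFS.isSentence_map.2 hψ) ∈ w.theory := by
      intro ψ hψ
      constructor
      · intro ht
        rw [← FOFS.val_of_isSentence hψ g]
        exact (FOFS.sat_iff ψ w g (hg _ _)).1 (ht g (hg _ _))
      · intro ht g' hg'
        refine (FOFS.sat_iff ψ w g' hg').2 ?_
        rwa [FOFS.val_of_isSentence hψ g']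
    exact hφN ((htrue φ hφ).1 (h _ FOFS.canonicalFrame_mem _ w fun γ hγ =>
      (htrue γ (hΓ γ hγ)).2 (hN ⟨rfl, γ, hγ, rfl⟩)))
  obtain ⟨l, hl, hle⟩ := hder.root fun b y hy => hy.1
  obtain ⟨l', h1, h2, h3⟩ := FOFS.exists_list_of_foldr_le hΓ FOFS.toRoot l fun x hx => (hl x hx).2
  rw [← h3, FOFS.cls_le] at hle
  -- The implication was proved for renamed sentences only; injectivity of `toRoot` carries it back.
  exact ⟨l', h1, FOFS.Thm.of_map FOFS.toRoot_injective (φ := .imp _ _) hle⟩
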